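/- Let $\mathcal S,\mathcal A$ be measurable spaces, $\nu$ a $\sigma$-finite reference measure on $\mathcal S$, $H,K\ge 1$ integers, $r:\mathcal S\times\mathcal A\to\mathbb R$ a known measurable reward and $s_0\in\mathcal S$. A *model* is a jointly measurable family of probability densities $P(\cdot\mid s,a)$ with respect to $\nu$, with $(s,a)\in\mathcal S\times\mathcal A$ (probability mass functions if $\nu$ is counting measure). Let $\mathcal P$ be a finite set of models containing the true time-homogeneous transition $P^\star$. Let $\Pi$ be the set of measurable deterministic non-stationary policies $\pi=\{\pi_h\}_{h=0}^{H-1}$, $\pi_h:\mathcal S\to\mathcal A$. Let $V^\pi_{h;P}(s)=\mathbb E_{\pi,P}\big[\sum_{t=h}^{H-1}r(s_t,a_t)\mid s_h=s\big]$ be the value of $\pi$ in $P$, $V^\pi=V^\pi_{0;P^\star}(s_0)$, $d^\pi_h$ the law of $(s_h,a_h)$ and $\mathrm{Var}_\pi$ the variance of the total reward $\sum_{h=0}^{H-1}r(s_h,a_h)$ when $\pi$ is executed in $P^\star$ from $s_0$. Assume the normalization $V^\pi_{h;P}(s)\in[0,1]$ for all $\pi\in\Pi$, $0\le h\le H$,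 $P\in\mathcal P$, $s\in\mathcal S$. The offline data set $\mathcal D$ consists of $K$ random trajectories $(s^k_0,a^k_0,\dots,s^k_{H-1},a^k_{H-1},s^k_H)$, $k=1,\dots,K$, with $s_0^k=s_0$. They may be collected adaptively: the actions are arbitrary random variables, and the only requirement is that, conditionally on all earlier trajectories and on the $k$-th one up to $(s^k_h,a^k_h)$, the next state $s^k_{h+1}$ has law $P^\star(\cdot\mid s^k_h,a^k_h)$. Fix $\delta\in(0,1)$, let $\beta=4\log(|\mathcal P|/\delta)$, let the version space be $$\widehat{\mathcal P}=\Big\{P\in\mathcal P:\ \sum_{k=1}^{K}\sum_{h=0}^{H-1}\log P(s^k_{h+1}\mid s^k_h,a^k_h)\ \ge\ \max_{\widetilde P\in\mathcal P}\sum_{k=1}^{K}\sum_{h=0}^{H-1}\log\widetilde P(s^k_{h+1}\mid s^k_h,a^k_h)-\beta\Big\}$$ (with $\log 0=-\infty$), and let the algorithm return any $\hat\pi\in\arg\max_{\pi\in\Pi}\min_{P\in\widehat{\mathcal P}}V^\pi_{0;P}(s_0)$. For a comparator $\pi^*\in\Pi$ define the single-policy concentrability coefficient $$C^{\pi^*}_{\mathcal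 D}=\max_{0\le h<H,\ P\in\mathcal P}\frac{\mathbb E_{(s,a)\sim d^{\pi^*}_h}\mathbb H^2\big(P(s,a)\,\|\,P^\star(s,a)\big)}{\frac1K\sum_{k=1}^{K}\mathbb H^2\big(P(s^k_h,a^k_h)\,\|\,P^\star(s^k_h,a^k_h)\big)}\in[0,\infty],\qquad \mathbb H^2(p\|q)=\tfrac12\int(\sqrt p-\sqrt q)^2\,d\nu,$$ with $0/0=0$ and $x/0=\infty$ for $x>0$. Then there is a universal constant $c>0$ (in particular independent of $H$) such that, with probability at least $1-\delta$, simultaneously for every such $\hat\pi$, every comparator $\pi^*\in\Pi$ and every finite $C^{\pi^*}\ge C^{\pi^*}_{\mathcal D}$, $$V^{\pi^*}-V^{\hat\pi}\ \le\ c\left(\sqrt{\frac{C^{\pi^*}\,\mathrm{Var}_{\pi^*}\log(|\mathcal P|/\delta)}{K}}+\frac{C^{\pi^*}\log(|\mathcal P|/\delta)}{K}\right).$$ -/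

import Mathlib

open MeasureTheory ProbabilityTheory
open scoped ENNReal NNReal

namespace OfflineRL

/-- A transition model `S × A → Δ(S)`, given by probability densities with respect to a fixed
reference measure `ν` on the state space (counting measure: probability mass functions;
Lebesgue measure: probability density functions). -/
structure Model (S A : Type*) [MeasurableSpace S] [MeasurableSpace A] (ν : Measure S) where
  dens : S × A → S → ℝ≥0
  measurable_dens : Measurable (Function.uncurry dens)
  lintegral_dens : ∀ x, ∫⁻ y, (dens x y : ℝ≥0∞) ∂ν = 1

/-- A deterministic non-stationary policy `π = {π_0, π_1, …}`; in an MDP of horizon `H` only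
`π_0, …, π_{H-1}` play a role. -/
structure Policy (S A : Type*) [MeasurableSpace S] [MeasurableSpace A] where
  act : ℕ → S → A
  measurable_act : ∀ h, Measurable (act h)

/-- A data set of `K` trajectories `s_0, a_0, s_1, …, s_{H-1}, a_{H-1}, s_H`. -/
structure Dataset (S A : Type*) (H K : ℕ) where
  state : Fin K → Fin (H + 1) → S
  action : Fin K → Fin H → A

noncomputable section

section MDP

variable {S A : Type*} [MeasurableSpace S] [MeasurableSpace A] {ν : Measure S} [SigmaFinite ν]

/-- The Markov kernel `(s, a) ↦ P(s, a)` of a model. -/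
def Model.kernel (P : Model S A ν) : Kernel (S × A) S :=
  Kernel.withDensity (Kernel.const (S × A) ν) (fun x y => (P.dens x y : ℝ≥0∞))

/-- One step of the state process when `π` is executed in `P` at time `h`. -/
def stepKernel (P : Model S A ν) (π : Policy S A) (h : ℕ) : Kernel S S :=
  P.kernel.comap (fun s => (s, π.act h s)) (measurable_id.prodMk (π.measurable_act h))

/-- The law of the state trajectory `(s_h, s_{h+1}, …, s_{h+n})` when `π` is executed in `P`
starting from the state `s_h = s` at time `h`, as a kernel in `s`. -/
def trajKernel (P : Model S A ν) (π : Policy S A) : (n h : ℕ) → Kernel S (Fin (n + 1) → S)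
  | 0, _ => Kernel.deterministic (fun s _ => s) (measurable_pi_lambda _ fun _ => measurable_id)
  | n + 1, h =>
      (Kernel.id ×ₖ (trajKernel P π n (h + 1) ∘ₖ stepKernel P π h)).map
        (fun p => (Fin.cons p.1 p.2 : Fin (n + 1 + 1) → S))

/-- Total reward collected along the states `(s_h, …, s_{h+n})` at times `h, …, h+n-1`. -/
def totalReward (r : S × A → ℝ) (π : Policy S A) (n h : ℕ) (τ : Fin (n + 1) → S) : ℝ :=
  ∑ t : Fin n, r (τ t.castSucc, π.act (h + t) (τ t.castSucc))

/-- The value function `V^π_{h;P}(s)` for horizon `H`: expected total reward from time `h` on,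
starting at `s_h = s`. -/
def value (r : S × A → ℝ) (H : ℕ) (P : Model S A ν) (π : Policy S A) (h : ℕ) (s : S) : ℝ :=
  ∫ τ, totalReward r π (H - h) h τ ∂(trajKernel P π (H - h) h s)

/-- `Var_π`: the variance of the total reward of a trajectory of `π` in `P` started at `s₀`. -/
def returnVar (r : S × A → ℝ) (H : ℕ) (P : Model S A ν) (π : Policy S A) (s₀ : S) : ℝ :=
  variance (totalReward r π H 0) (trajKernel P π H 0 s₀)

/-- `d^π_h`: the law of `(s_h, a_h)` when `π` is executed in `P` from `s₀`. -/
def occupancy (H : ℕ) (P : Model S A ν) (π : Policy S A) (s₀ : S) (h : Fin H) :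
    Measure (S × A) :=
  (trajKernel P π H 0 s₀).map (fun τ => (τ h.castSucc, π.act h (τ h.castSucc)))

/-- The squared Hellinger distance `H²(P(x) ‖ Q(x))` at a state-action pair `x`. -/
def hellingerSq (P Q : Model S A ν) (x : S × A) : ℝ≥0∞ :=
  2⁻¹ * ∫⁻ y, ENNReal.ofReal ((√(P.dens x y : ℝ) - √(Q.dens x y : ℝ)) ^ 2) ∂ν

/-- Log-likelihood of a model on a data set, with `log 0 = -∞`. -/
def logLik {H K : ℕ} (P : Model S A ν) (D : Dataset S A H K) : EReal :=
  ∑ k : Fin K, ∑ h : Fin H,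
    ENNReal.log (P.dens (D.state k h.castSucc, D.action k h) (D.state k h.succ) : ℝ≥0∞)

/-- The version space around the maximum likelihood estimator, with threshold `β`. -/
def versionSpace {H K : ℕ} (ℳ : Finset (Model S A ν)) (β : ℝ) (D : Dataset S A H K) :
    Set (Model S A ν) :=
  {P | P ∈ ℳ ∧ (⨆ Q ∈ ℳ, logLik Q D) - (β : EReal) ≤ logLik P D}

/-- `π̂ ∈ argmax_π min_{P ∈ version space} V^π_{0;P}(s₀)`: `π̂` is an output of pessimistic
planning on the data set `D`. -/
def IsPessimisticPolicy {H K : ℕ} (r : S × A → ℝ) (s₀ : S) (ℳ : Finset (Model S A ν)) (β : ℝ)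
    (D : Dataset S A H K) (πhat : Policy S A) : Prop :=
  ∀ π : Policy S A,
    (⨅ P : versionSpace ℳ β D, value r H P.1 π 0 s₀) ≤
      ⨅ P : versionSpace ℳ β D, value r H P.1 πhat 0 s₀

/-- The data-dependent single-policy concentrability coefficient
`max_{h, P ∈ ℳ} E_{(s,a) ∼ d^π_h} H²(P(s,a) ‖ P⋆(s,a)) / (K⁻¹ ∑_k H²(P(s_h^k,a_h^k) ‖ P⋆(s_h^k,a_h^k)))`
in `[0, ∞]`, where `0 / 0 = 0` and `x / 0 = ∞` for `x > 0`. -/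
def concentrability {H K : ℕ} (ℳ : Finset (Model S A ν)) (Pstar : Model S A ν) (s₀ : S)
    (π : Policy S A) (D : Dataset S A H K) : ℝ≥0∞ :=
  ⨆ h : Fin H, ⨆ P ∈ ℳ,
    (∫⁻ x, hellingerSq P Pstar x ∂(occupancy H Pstar π s₀ h)) /
      ((K : ℝ≥0∞)⁻¹ * ∑ k : Fin K, hellingerSq P Pstar (D.state k h.castSucc, D.action k h))

end MDP

section Data

variable {S A Ω : Type*} [MeasurableSpace S] [MeasurableSpace A]

/-- The σ-algebra of the history up to and including `(s_h^k, a_h^k)`: all earlier trajectories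
and the `k`-th one up to its `h`-th state and action. -/
abbrev history {H K : ℕ} (D : Ω → Dataset S A H K) (k : Fin K) (h : Fin H) : MeasurableSpace Ω :=
  (⨆ (i : Fin K) (_ : i < k) (j : Fin (H + 1)),
      MeasurableSpace.comap (fun ω => (D ω).state i j) inferInstance) ⊔
  (⨆ (i : Fin K) (_ : i < k) (j : Fin H),
      MeasurableSpace.comap (fun ω => (D ω).action i j) inferInstance) ⊔
  (⨆ (j : Fin (H + 1)) (_ : j ≤ h.castSucc),
      MeasurableSpace.comap (fun ω => (D ω).state k j) inferInstance) ⊔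
  (⨆ (j : Fin H) (_ : j ≤ h),
      MeasurableSpace.comap (fun ω => (D ω).action k j) inferInstance)

/-- `D` is a random, possibly adaptively collected data set for the MDP with transition `Pstar`
and initial state `s₀`: each trajectory starts at `s₀`, the actions are arbitrary random
variables, and the conditional law of `s_{h+1}^k` given the history up to and including
`(s_h^k, a_h^k)` is `Pstar(s_h^k, a_h^k)`. -/
structure IsOfflineDataset [MeasurableSpace Ω] {ν : Measure S} [SigmaFinite ν] {H K : ℕ}
    (μ : Measure Ω) (Pstar : Model S A ν) (s₀ : S) (D : Ω → Dataset S A H K) : Prop where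
  measurable_state : ∀ k j, Measurable (fun ω => (D ω).state k j)
  measurable_action : ∀ k h, Measurable (fun ω => (D ω).action k h)
  initial : ∀ k, ∀ᵐ ω ∂μ, (D ω).state k 0 = s₀
  transition : ∀ (k : Fin K) (h : Fin H) (B : Set S), MeasurableSet B →
    ∀ G : Set Ω, MeasurableSet[history D k h] G →
      μ (G ∩ {ω | (D ω).state k h.succ ∈ B}) =
        ∫⁻ ω in G, Pstar.kernel ((D ω).state k h.castSucc, (D ω).action k h) B ∂μ

end Data

end

end OfflineRL

open OfflineRL

universe u v w

/-! Write `Q` for the true model and L = log(|ℳ|/δ). Three estimates are chained.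

Pessimism: if `Q` lies in the version space, the regret against a comparator is at most V_Q − V_P
for that comparator alone, where P is a model of the version space
(`IsPessimisticPolicy.exists_value_sub_le`). The learned policy drops out.

Second-order simulation (`abs_value_sub_le`): let e be the total expected squared Hellinger error
along the comparator in `Q`, and B the total expected one-step error |(P − Q)V_P|. A one-step change
of measure, summed over time, gives B ≤ tX + (2/t + 2)e for every t > 0, where X sums the one-step
variances of V_P under `Q`. The corresponding sum for V_Q is exactly the variance v of the return
(`variance_totalReward`), and the sum for V_P − V_Q is at most 2B (`value_sub_sq_add_expSum_le`). So
X ≤ 2v + 4B, which is self-bounding; optimizing t yields B ≲ √(ev) + e. Horizon factors never enter,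
because only sums over the whole trajectory are compared.

Maximum likelihood (`IsOfflineDataset.exists_event`): the factors exp(H²)·√(P/Q) have conditional
mean at most 1 given the history, so their product has mean at most 1 even for adaptive data.
Markov's inequality and a union bound over ℳ put `Q` in the version space and bound the total
Hellinger error on the data by 3L for all its members. Concentrability, summed over time steps,
turns this into e ≤ 3CL/K. -/

namespace OfflineRL

/-! ### Trajectory laws, expected sums and the law of total variance -/

section MDP

variable {S A : Type*} [MeasurableSpace S] [MeasurableSpace A] {ν : Measure S} [SigmaFinite ν]

theorem integrable_of_abs_le {α : Type*} [MeasurableSpace α] {μ : Measure α} [IsFiniteMeasure μ]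
    {f : α → ℝ} (hf : Measurable f) {M : ℝ} (hM : ∀ x, |f x| ≤ M) : Integrable f μ :=
  Integrable.of_bound hf.aestronglyMeasurable M (.of_forall hM)

theorem abs_integral_le_of_abs_le {α : Type*} [MeasurableSpace α] {μ : Measure α}
    [IsProbabilityMeasure μ] {f : α → ℝ} {M : ℝ} (hM : ∀ x, |f x| ≤ M) : |∫ x, f x ∂μ| ≤ M := by
  have := norm_integral_le_of_norm_le_const (μ := μ) (f := f) (C := M) (.of_forall hM)
  simpa using this

theorem Model.measurable_dens_ennreal (P : Model S A ν) :
    Measurable (Function.uncurry fun x y => (P.dens x y : ℝ≥0∞)) :=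
  measurable_coe_nnreal_ennreal.comp P.measurable_dens

theorem Model.kernel_apply (P : Model S A ν) (x : S × A) :
    P.kernel x = ν.withDensity fun y => (P.dens x y : ℝ≥0∞) := by
  rw [Model.kernel, Kernel.withDensity_apply _ P.measurable_dens_ennreal, Kernel.const_apply]

instance Model.isMarkovKernel_kernel (P : Model S A ν) : IsMarkovKernel P.kernel :=
  ⟨fun x => ⟨by
    rw [P.kernel_apply, withDensity_apply _ MeasurableSet.univ, Measure.restrict_univ,
      P.lintegral_dens]⟩⟩

instance isMarkovKernel_stepKernel (P : Model S A ν) (π : Policy S A) (h : ℕ) :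
    IsMarkovKernel (stepKernel P π h) := by
  unfold stepKernel; infer_instance

theorem stepKernel_apply (P : Model S A ν) (π : Policy S A) (h : ℕ) (s : S) :
    stepKernel P π h s = P.kernel (s, π.act h s) := by
  rw [stepKernel, Kernel.comap_apply]

theorem measurable_finCons (n : ℕ) :
    Measurable fun p : S × (Fin (n + 1) → S) => (Fin.cons p.1 p.2 : Fin (n + 1 + 1) → S) := by
  refine measurable_pi_lambda _ fun i => ?_
  refine Fin.cases ?_ (fun j => ?_) i
  · simpa using measurable_fst
  · simpa [Function.comp_def] using (measurable_pi_apply j).comp measurable_snd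

instance isMarkovKernel_trajKernel (P : Model S A ν) (π : Policy S A) (n h : ℕ) :
    IsMarkovKernel (trajKernel P π n h) := by
  induction n generalizing h with
  | zero => unfold trajKernel; infer_instance
  | succ n ih =>
    unfold trajKernel
    have := ih (h + 1)
    exact Kernel.IsMarkovKernel.map _ (measurable_finCons n)

theorem trajKernel_succ_apply (P : Model S A ν) (π : Policy S A) (n h : ℕ) (s : S) :
    trajKernel P π (n + 1) h s =
      ((trajKernel P π n (h + 1) ∘ₖ stepKernel P π h) s).map
        (fun τ => (Fin.cons s τ : Fin (n + 1 + 1) → S)) := by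
  rw [trajKernel, Kernel.map_apply _ (measurable_finCons n), Kernel.prod_apply, Kernel.id_apply,
    Measure.dirac_prod, Measure.map_map (measurable_finCons n) measurable_prodMk_left]
  rfl

theorem measurable_finCons_right (n : ℕ) (s : S) :
    Measurable fun τ : Fin (n + 1) → S => (Fin.cons s τ : Fin (n + 1 + 1) → S) :=
  (measurable_finCons n).comp measurable_prodMk_left

theorem lintegral_trajKernel_succ (P : Model S A ν) (π : Policy S A) (n h : ℕ) (s : S)
    {f : (Fin (n + 1 + 1) → S) → ℝ≥0∞} (hf : Measurable f) :
    ∫⁻ τ, f τ ∂(trajKernel P π (n + 1) h s) =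
      ∫⁻ s', ∫⁻ τ, f (Fin.cons s τ) ∂(trajKernel P π n (h + 1) s') ∂(stepKernel P π h s) := by
  have hf' : Measurable fun τ : Fin (n + 1) → S => f (Fin.cons s τ) :=
    hf.comp (measurable_finCons_right n s)
  rw [trajKernel_succ_apply, lintegral_map hf (measurable_finCons_right n s),
    Kernel.lintegral_comp _ _ _ hf']

theorem integral_trajKernel_succ (P : Model S A ν) (π : Policy S A) (n h : ℕ) (s : S)
    {f : (Fin (n + 1 + 1) → S) → ℝ} (hf : Measurable f) {M : ℝ} (hM : ∀ τ, |f τ| ≤ M) :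
    ∫ τ, f τ ∂(trajKernel P π (n + 1) h s) =
      ∫ s', ∫ τ, f (Fin.cons s τ) ∂(trajKernel P π n (h + 1) s') ∂(stepKernel P π h s) := by
  rw [trajKernel_succ_apply, integral_map (measurable_finCons_right n s).aemeasurable
    hf.aestronglyMeasurable, Kernel.integral_comp]
  exact integrable_of_abs_le (hf.comp (measurable_finCons_right n s)) fun τ => hM _

theorem integral_const_add_mul_add {α : Type*} [MeasurableSpace α] {μ : Measure α}
    [IsProbabilityMeasure μ] {f g : α → ℝ} (hf : Integrable f μ) (hg : Integrable g μ) (a b : ℝ) :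
    ∫ x, (a + b * f x + g x) ∂μ = a + b * ∫ x, f x ∂μ + ∫ x, g x ∂μ := by
  have h1 : Integrable (fun x => a + b * f x) μ := (integrable_const a).add (hf.const_mul b)
  rw [integral_add h1 hg, integral_add (integrable_const a) (hf.const_mul b), integral_const_mul]
  simp

theorem measurable_integral_kernel {α β : Type*} [MeasurableSpace α] [MeasurableSpace β]
    (κ : Kernel α β) [IsSFiniteKernel κ] {f : β → ℝ} (hf : Measurable f) :
    Measurable fun a => ∫ b, f b ∂(κ a) :=
  (StronglyMeasurable.integral_kernel hf.stronglyMeasurable).measurable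

/-- The expected sum `E[∑_{t=h}^{h+n-1} F_t(s_t) | s_h = s]` when `π` is executed in `P`. -/
noncomputable def expSum (P : Model S A ν) (π : Policy S A) (F : ℕ → S → ℝ) : ℕ → ℕ → S → ℝ
  | 0, _, _ => 0
  | n + 1, h, s => F h s + ∫ s', expSum P π F n (h + 1) s' ∂(stepKernel P π h s)

theorem measurable_expSum (P : Model S A ν) (π : Policy S A) {F : ℕ → S → ℝ}
    (hF : ∀ h, Measurable (F h)) (n h : ℕ) : Measurable (expSum P π F n h) := by
  induction n generalizing h with
  | zero => exact measurable_const
  | succ n ih => exact (hF h).add (measurable_integral_kernel _ (ih (h + 1)))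

theorem abs_expSum_le (P : Model S A ν) (π : Policy S A) {F : ℕ → S → ℝ} {M : ℝ}
    (hM : ∀ h s, |F h s| ≤ M) (n h : ℕ) (s : S) : |expSum P π F n h s| ≤ n * M := by
  induction n generalizing h s with
  | zero => simp [expSum]
  | succ n ih =>
    rw [expSum]
    refine (abs_add_le _ _).trans ?_
    have := abs_integral_le_of_abs_le (μ := stepKernel P π h s) (ih (h + 1))
    push_cast
    linarith [hM h s]

theorem integrable_expSum (P : Model S A ν) (π : Policy S A) {F : ℕ → S → ℝ}
    (hF : ∀ h, Measurable (F h)) {M : ℝ} (hM : ∀ h s, |F h s| ≤ M) (n h : ℕ) (μ : Measure S)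
    [IsFiniteMeasure μ] : Integrable (expSum P π F n h) μ :=
  integrable_of_abs_le (measurable_expSum P π hF n h) (abs_expSum_le P π hM n h)

theorem expSum_nonneg (P : Model S A ν) (π : Policy S A) {F : ℕ → S → ℝ}
    (hF : ∀ h s, 0 ≤ F h s) (n h : ℕ) (s : S) : 0 ≤ expSum P π F n h s := by
  induction n generalizing h s with
  | zero => exact le_rfl
  | succ n ih => exact add_nonneg (hF h s) (integral_nonneg (ih (h + 1)))

/-- Sums pointwise one-step inequalities along a trajectory without losing a factor of the horizon.
-/
theorem expSum_le_combination (P : Model S A ν) (π : Policy S A) {F G₁ G₂ : ℕ → S → ℝ}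
    (hF : ∀ h, Measurable (F h)) (hG₁ : ∀ h, Measurable (G₁ h)) (hG₂ : ∀ h, Measurable (G₂ h))
    {M M₁ M₂ : ℝ} (hM : ∀ h s, |F h s| ≤ M) (hM₁ : ∀ h s, |G₁ h s| ≤ M₁)
    (hM₂ : ∀ h s, |G₂ h s| ≤ M₂) {a b : ℝ} (hle : ∀ h s, F h s ≤ a * G₁ h s + b * G₂ h s)
    (n h : ℕ) (s : S) :
    expSum P π F n h s ≤ a * expSum P π G₁ n h s + b * expSum P π G₂ n h s := by
  induction n generalizing h s with
  | zero => simp [expSum]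
  | succ n ih =>
    simp only [expSum]
    have h1 := (integrable_expSum P π hG₁ hM₁ n (h + 1) (stepKernel P π h s)).const_mul a
    have h2 := (integrable_expSum P π hG₂ hM₂ n (h + 1) (stepKernel P π h s)).const_mul b
    have key := integral_mono (integrable_expSum P π hF hM n (h + 1) (stepKernel P π h s))
      (h1.add h2) (ih (h + 1))
    simp only [Pi.add_apply] at key
    rw [integral_add h1 h2, integral_const_mul, integral_const_mul] at key
    linarith [hle h s]

theorem measurable_totalReward {r : S × A → ℝ} (hr : Measurable r) (π : Policy S A) (n h : ℕ) :
    Measurable (totalReward r π n h) := by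
  unfold totalReward
  refine Finset.measurable_sum _ fun t _ => hr.comp ?_
  exact (measurable_pi_apply _).prodMk ((π.measurable_act _).comp (measurable_pi_apply _))

theorem abs_totalReward_le {r : S × A → ℝ} (hr : ∀ x, r x ∈ Set.Icc (0 : ℝ) 1) (π : Policy S A)
    (n h : ℕ) (τ : Fin (n + 1) → S) : |totalReward r π n h τ| ≤ n := by
  unfold totalReward
  refine (Finset.abs_sum_le_sum_abs _ _).trans ?_
  refine (Finset.sum_le_sum (g := fun _ => (1 : ℝ)) fun t _ => ?_).trans (by simp)
  rw [abs_of_nonneg (hr _).1]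
  exact (hr _).2

theorem totalReward_cons (r : S × A → ℝ) (π : Policy S A) (n h : ℕ) (s : S)
    (τ : Fin (n + 1) → S) :
    totalReward r π (n + 1) h (Fin.cons s τ) =
      r (s, π.act h s) + totalReward r π n (h + 1) τ := by
  unfold totalReward
  rw [Fin.sum_univ_succ]
  congr 1
  refine Finset.sum_congr rfl fun t _ => ?_
  have : h + ((t.succ : Fin (n + 1)) : ℕ) = h + 1 + t := by simp; ring
  rw [this, ← Fin.succ_castSucc, Fin.cons_succ]

theorem integrable_totalReward {r : S × A → ℝ} (hrm : Measurable r)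
    (hr : ∀ x, r x ∈ Set.Icc (0 : ℝ) 1) (P : Model S A ν) (π : Policy S A) (n h : ℕ) (s : S) :
    Integrable (totalReward r π n h) (trajKernel P π n h s) :=
  integrable_of_abs_le (measurable_totalReward hrm π n h) (abs_totalReward_le hr π n h)

theorem measurable_value {r : S × A → ℝ} (hrm : Measurable r) (H : ℕ) (P : Model S A ν)
    (π : Policy S A) (h : ℕ) : Measurable (value r H P π h) :=
  measurable_integral_kernel _ (measurable_totalReward hrm π _ _)

theorem integral_totalReward_succ {r : S × A → ℝ} (hrm : Measurable r)
    (hr : ∀ x, r x ∈ Set.Icc (0 : ℝ) 1) (P : Model S A ν) (π : Policy S A) (n h : ℕ) (s : S) :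
    ∫ τ, totalReward r π (n + 1) h τ ∂(trajKernel P π (n + 1) h s) =
      r (s, π.act h s) + ∫ s', ∫ τ, totalReward r π n (h + 1) τ ∂(trajKernel P π n (h + 1) s')
        ∂(stepKernel P π h s) := by
  rw [integral_trajKernel_succ P π n h s (measurable_totalReward hrm π _ _)
    (abs_totalReward_le hr π _ _)]
  simp_rw [totalReward_cons]
  have h1 : ∀ s', ∫ τ, r (s, π.act h s) + totalReward r π n (h + 1) τ
      ∂(trajKernel P π n (h + 1) s') = r (s, π.act h s) +
        ∫ τ, totalReward r π n (h + 1) τ ∂(trajKernel P π n (h + 1) s') := fun s' => by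
    rw [integral_add (integrable_const _) (integrable_totalReward hrm hr P π n (h + 1) s')]
    simp
  simp_rw [h1]
  rw [integral_add (integrable_const _)]
  · simp
  · exact integrable_of_abs_le
      (measurable_integral_kernel _ (measurable_totalReward hrm π _ _))
      fun s' => abs_integral_le_of_abs_le (abs_totalReward_le hr π _ _)

theorem value_of_lt {r : S × A → ℝ} (hrm : Measurable r) (hr : ∀ x, r x ∈ Set.Icc (0 : ℝ) 1)
    {H h : ℕ} (hH : h < H) (P : Model S A ν) (π : Policy S A) (s : S) :
    value r H P π h s =
      r (s, π.act h s) + ∫ s', value r H P π (h + 1) s' ∂(stepKernel P π h s) := by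
  have : H - h = H - (h + 1) + 1 := by omega
  unfold value
  rw [this, integral_totalReward_succ hrm hr]

theorem value_of_le {r : S × A → ℝ} {H h : ℕ} (hH : H ≤ h) (P : Model S A ν) (π : Policy S A)
    (s : S) : value r H P π h s = 0 := by
  have : H - h = 0 := by omega
  unfold value
  rw [this]
  simp [totalReward]

/-- At the last decision time the value of a constant policy is the reward itself, so the
normalization of values bounds the reward pointwise. This makes every later integrand bounded. -/
theorem reward_mem_Icc {r : S × A → ℝ} {H : ℕ} (hH : 0 < H) (P : Model S A ν)
    (hval : ∀ (π : Policy S A) (h : ℕ), h ≤ H → ∀ s : S,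
      value r H P π h s ∈ Set.Icc (0 : ℝ) 1) (hrm : Measurable r) (x : S × A) :
    r x ∈ Set.Icc (0 : ℝ) 1 := by
  let π : Policy S A := ⟨fun _ _ => x.2, fun _ => measurable_const⟩
  have h1 := hval π (H - 1) (by omega) x.1
  have h2 : value r H P π (H - 1) x.1 = r x := by
    have : H - (H - 1) = 0 + 1 := by omega
    unfold value
    rw [this, trajKernel_succ_apply, integral_map (measurable_finCons_right 0 _).aemeasurable
      (measurable_totalReward hrm π _ _).aestronglyMeasurable]
    simp_rw [totalReward_cons]
    simp [totalReward, π]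
  rwa [h2] at h1

/-- Law of total variance: given the next state, the variance splits into the variance of the
remaining return and that of its conditional mean, the next value. The current reward is a constant
because the policy is deterministic. -/
theorem variance_totalReward {r : S × A → ℝ} (hrm : Measurable r)
    (hr : ∀ x, r x ∈ Set.Icc (0 : ℝ) 1) {H : ℕ} (P : Model S A ν) (π : Policy S A) (n h : ℕ)
    (hn : h + n = H) (s : S) :
    variance (totalReward r π n h) (trajKernel P π n h s) =
      expSum P π (fun h s => variance (value r H P π (h + 1)) (stepKernel P π h s)) n h s := by
  have hvar : ∀ n h s, variance (totalReward r π n h) (trajKernel P π n h s) =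
      (∫ τ, totalReward r π n h τ ^ 2 ∂(trajKernel P π n h s)) -
      (∫ τ, totalReward r π n h τ ∂(trajKernel P π n h s)) ^ 2 := fun n h s => by
    rw [variance_eq_sub (MemLp.of_bound
      (measurable_totalReward hrm π n h).aestronglyMeasurable n
      (.of_forall (abs_totalReward_le hr π n h)))]
    rfl
  induction n generalizing h s with
  | zero =>
    have : totalReward r π 0 h = fun _ => 0 := by ext; simp [totalReward]
    rw [this, expSum]
    exact variance_zero _
  | succ n ih =>
    have hsq : ∀ n h τ, |totalReward r π n h τ ^ 2| ≤ (n : ℝ) ^ 2 := fun n h τ => by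
      rw [abs_pow]
      exact pow_le_pow_left₀ (abs_nonneg _) (abs_totalReward_le hr π n h τ) 2
    have hVal : ∀ s', ∫ τ, totalReward r π n (h + 1) τ ∂(trajKernel P π n (h + 1) s') =
        value r H P π (h + 1) s' := fun s' => by
      have : H - (h + 1) = n := by omega
      unfold value
      rw [this]
    have hVm := measurable_value hrm H P π (h + 1)
    have hVb : ∀ s', |value r H P π (h + 1) s'| ≤ n := fun s' => by
      rw [← hVal]; exact abs_integral_le_of_abs_le (abs_totalReward_le hr π _ _)
    have hSm : Measurable fun s' => ∫ τ, totalReward r π n (h + 1) τ ^ 2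
        ∂(trajKernel P π n (h + 1) s') :=
      measurable_integral_kernel _ ((measurable_totalReward hrm π _ _).pow_const 2)
    have hSb : ∀ s', |∫ τ, totalReward r π n (h + 1) τ ^ 2 ∂(trajKernel P π n (h + 1) s')| ≤
        (n : ℝ) ^ 2 := fun s' => abs_integral_le_of_abs_le (hsq _ _)
    rw [hvar, integral_totalReward_succ hrm hr, integral_trajKernel_succ P π n h s
      ((measurable_totalReward hrm π _ _).pow_const 2) (hsq _ _), expSum]
    simp_rw [← ih (h + 1) (by omega), hvar, totalReward_cons, hVal]
    set c := r (s, π.act h s)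
    have hin : ∀ s', ∫ τ, (c + totalReward r π n (h + 1) τ) ^ 2 ∂(trajKernel P π n (h + 1) s') =
        c ^ 2 + 2 * c * value r H P π (h + 1) s' +
          ∫ τ, totalReward r π n (h + 1) τ ^ 2 ∂(trajKernel P π n (h + 1) s') := fun s' => by
      have e : ∀ τ, (c + totalReward r π n (h + 1) τ) ^ 2 =
        (c ^ 2 + 2 * c * totalReward r π n (h + 1) τ) + totalReward r π n (h + 1) τ ^ 2 :=
        fun τ => by ring
      simp_rw [e]
      rw [integral_const_add_mul_add (integrable_totalReward hrm hr P π n (h + 1) s'), hVal]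
      exact integrable_of_abs_le ((measurable_totalReward hrm π _ _).pow_const 2) (hsq _ _)
    simp_rw [hin]
    have j1 : Integrable (value r H P π (h + 1)) (stepKernel P π h s) :=
      integrable_of_abs_le hVm hVb
    have j2 : Integrable (fun s' => ∫ τ, totalReward r π n (h + 1) τ ^ 2
        ∂(trajKernel P π n (h + 1) s')) (stepKernel P π h s) := integrable_of_abs_le hSm hSb
    have j3 : Integrable (fun s' => value r H P π (h + 1) s' ^ 2) (stepKernel P π h s) := by
      refine integrable_of_abs_le (hVm.pow_const 2) (M := (n : ℝ) ^ 2) fun s' => ?_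
      rw [abs_pow]
      exact pow_le_pow_left₀ (abs_nonneg _) (hVb s') 2
    rw [integral_const_add_mul_add j1 j2, integral_sub j2 j3, variance_eq_sub (MemLp.of_bound
      hVm.aestronglyMeasurable n (.of_forall hVb))]
    simp only [Pi.pow_apply]
    ring

theorem returnVar_eq_expSum {r : S × A → ℝ} (hrm : Measurable r)
    (hr : ∀ x, r x ∈ Set.Icc (0 : ℝ) 1) (H : ℕ) (P : Model S A ν) (π : Policy S A) (s : S) :
    returnVar r H P π s =
      expSum P π (fun h s => variance (value r H P π (h + 1)) (stepKernel P π h s)) H 0 s :=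
  variance_totalReward hrm hr P π H 0 (by omega) s

/-- Bridge between the backward recursion `expSum` and marginals of the trajectory law, needed
because concentrability is phrased through occupancies. -/
theorem sum_lintegral_trajKernel (P : Model S A ν) (π : Policy S A) {F : ℕ → S → ℝ}
    (hF : ∀ h, Measurable (F h)) (hF0 : ∀ h s, 0 ≤ F h s) {M : ℝ} (hM : ∀ h s, |F h s| ≤ M)
    (n h : ℕ) (s : S) :
    ∑ t : Fin n, ∫⁻ τ, ENNReal.ofReal (F (h + t) (τ t.castSucc)) ∂(trajKernel P π n h s) =
      ENNReal.ofReal (expSum P π F n h s) := by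
  induction n generalizing h s with
  | zero => simp [expSum]
  | succ n ih =>
    have hm : ∀ (n k : ℕ) (t : Fin n),
        Measurable fun τ : Fin (n + 1) → S => ENNReal.ofReal (F k (τ t.castSucc)) :=
      fun n k t => ((hF k).comp (measurable_pi_apply _)).ennreal_ofReal
    simp_rw [lintegral_trajKernel_succ P π n h s (hm _ _ _)]
    rw [Fin.sum_univ_succ, expSum, ENNReal.ofReal_add (hF0 h s)
      (integral_nonneg (expSum_nonneg P π hF0 n (h + 1))), ofReal_integral_eq_lintegral_ofReal
      (integrable_expSum P π hF hM n (h + 1) _) (.of_forall (expSum_nonneg P π hF0 n (h + 1)))]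
    congr 1
    · simp
    · simp_rw [← ih (h + 1)]
      rw [lintegral_finsetSum _ fun t _ => (hm n _ t).lintegral_kernel]
      refine Finset.sum_congr rfl fun t _ => ?_
      have : h + ((t.succ : Fin (n + 1)) : ℕ) = h + 1 + t := by simp; ring
      simp_rw [this, ← Fin.succ_castSucc, Fin.cons_succ]

end MDP
end OfflineRL

namespace OfflineRL

/-! ### Hellinger change of measure and the second-order simulation lemma -/

section Simulation

variable {S A : Type*} [MeasurableSpace S] [MeasurableSpace A] {ν : Measure S} [SigmaFinite ν]

theorem Model.measurable_dens_apply (P : Model S A ν) (x : S × A) : Measurable (P.dens x) :=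
  P.measurable_dens.comp measurable_prodMk_left

theorem Model.integrable_dens (P : Model S A ν) (x : S × A) :
    Integrable (fun y => (P.dens x y : ℝ)) ν := by
  refine ⟨(P.measurable_dens_apply x).coe_nnreal_real.aestronglyMeasurable, ?_⟩
  rw [hasFiniteIntegral_iff_ofReal (.of_forall fun y => NNReal.coe_nonneg _)]
  simp [P.lintegral_dens x]

theorem Model.integral_dens (P : Model S A ν) (x : S × A) : ∫ y, (P.dens x y : ℝ) ∂ν = 1 := by
  rw [integral_eq_lintegral_of_nonneg_ae (.of_forall fun y => NNReal.coe_nonneg _)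
    (P.integrable_dens x).aestronglyMeasurable]
  simp [P.lintegral_dens x]

theorem Model.integral_kernel (P : Model S A ν) (x : S × A) (f : S → ℝ) :
    ∫ y, f y ∂(P.kernel x) = ∫ y, (P.dens x y : ℝ) * f y ∂ν := by
  rw [P.kernel_apply, integral_withDensity_eq_integral_smul (P.measurable_dens_apply x)]
  rfl

theorem Model.integrable_dens_mul (P : Model S A ν) (x : S × A) {f : S → ℝ} (hf : Measurable f)
    {M : ℝ} (hM : ∀ y, |f y| ≤ M) : Integrable (fun y => (P.dens x y : ℝ) * f y) ν :=
  (P.integrable_dens x).mul_bdd hf.aestronglyMeasurable (.of_forall hM)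

theorem measurable_sqrt_dens_sub_sq (P Q : Model S A ν) (x : S × A) :
    Measurable fun y => (√(P.dens x y : ℝ) - √(Q.dens x y : ℝ)) ^ 2 :=
  ((P.measurable_dens_apply x).coe_nnreal_real.sqrt.sub
    (Q.measurable_dens_apply x).coe_nnreal_real.sqrt).pow_const 2

theorem sqrt_sub_sqrt_sq_le (p q : ℝ≥0) : (√(p : ℝ) - √(q : ℝ)) ^ 2 ≤ p + q := by
  nlinarith [Real.sq_sqrt p.coe_nonneg, Real.sq_sqrt q.coe_nonneg,
    mul_nonneg (Real.sqrt_nonneg (p : ℝ)) (Real.sqrt_nonneg (q : ℝ))]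

theorem integrable_sqrt_dens_sub_sq (P Q : Model S A ν) (x : S × A) :
    Integrable (fun y => (√(P.dens x y : ℝ) - √(Q.dens x y : ℝ)) ^ 2) ν := by
  refine ((P.integrable_dens x).add (Q.integrable_dens x)).mono'
    (measurable_sqrt_dens_sub_sq P Q x).aestronglyMeasurable (.of_forall fun y => ?_)
  rw [Real.norm_of_nonneg (sq_nonneg _)]
  exact sqrt_sub_sqrt_sq_le _ _

theorem hellingerSq_eq_ofReal (P Q : Model S A ν) (x : S × A) :
    hellingerSq P Q x =
      ENNReal.ofReal (2⁻¹ * ∫ y, (√(P.dens x y : ℝ) - √(Q.dens x y : ℝ)) ^ 2 ∂ν) := by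
  rw [hellingerSq, ENNReal.ofReal_mul (by norm_num),
    ofReal_integral_eq_lintegral_ofReal (integrable_sqrt_dens_sub_sq P Q x)
      (.of_forall fun y => sq_nonneg _), ENNReal.ofReal_inv_of_pos (by norm_num)]
  simp

theorem toReal_hellingerSq (P Q : Model S A ν) (x : S × A) :
    (hellingerSq P Q x).toReal =
      2⁻¹ * ∫ y, (√(P.dens x y : ℝ) - √(Q.dens x y : ℝ)) ^ 2 ∂ν := by
  rw [hellingerSq_eq_ofReal, ENNReal.toReal_ofReal]
  exact mul_nonneg (by norm_num) (integral_nonneg fun y => sq_nonneg _)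

theorem hellingerSq_ne_top (P Q : Model S A ν) (x : S × A) : hellingerSq P Q x ≠ ⊤ := by
  rw [hellingerSq_eq_ofReal]
  exact ENNReal.ofReal_ne_top

theorem toReal_hellingerSq_le_one (P Q : Model S A ν) (x : S × A) :
    (hellingerSq P Q x).toReal ≤ 1 := by
  have h := integral_mono (integrable_sqrt_dens_sub_sq P Q x)
    ((P.integrable_dens x).add (Q.integrable_dens x)) fun y => sqrt_sub_sqrt_sq_le _ _
  simp only [Pi.add_apply] at h
  rw [integral_add (P.integrable_dens x) (Q.integrable_dens x), P.integral_dens,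
    Q.integral_dens] at h
  rw [toReal_hellingerSq]
  linarith

theorem measurable_hellingerSq (P Q : Model S A ν) : Measurable (hellingerSq P Q) := by
  unfold hellingerSq
  refine Measurable.const_mul (Measurable.lintegral_prod_right' (f := fun z : (S × A) × S =>
    ENNReal.ofReal ((√(P.dens z.1 z.2 : ℝ) - √(Q.dens z.1 z.2 : ℝ)) ^ 2)) ?_) _
  exact ((P.measurable_dens.coe_nnreal_real.sqrt.sub
    Q.measurable_dens.coe_nnreal_real.sqrt).pow_const 2).ennreal_ofReal

/-- With a = √p and b = √q, p − q = 2b(a − b) + (a − b)². Weighted AM-GM handles the first term, so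
that only q, and not p, multiplies g². -/
theorem abs_sub_mul_le (p q : ℝ≥0) {g t : ℝ} (hg : |g| ≤ 1) (ht : 0 < t) :
    |((p : ℝ) - q) * g| ≤ t * (q * g ^ 2) + (1 / t + 1) * (√(p : ℝ) - √(q : ℝ)) ^ 2 := by
  have hp := Real.sq_sqrt p.coe_nonneg
  have hq := Real.sq_sqrt q.coe_nonneg
  set a := √(p : ℝ)
  set b := √(q : ℝ)
  have hb : 0 ≤ b := Real.sqrt_nonneg _
  have e : ((p : ℝ) - q) * g = 2 * ((b * g) * (a - b)) + (a - b) ^ 2 * g := by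
    rw [← hp, ← hq]; ring
  have h1 : |2 * ((b * g) * (a - b))| ≤ t * (b * g) ^ 2 + 1 / t * (a - b) ^ 2 := by
    have key : t * (b * g) ^ 2 + 1 / t * (a - b) ^ 2 - 2 * (|b * g| * |a - b|) =
        (t * |b * g| - |a - b|) ^ 2 / t := by
      rw [← sq_abs (b * g), ← sq_abs (a - b)]
      field_simp
      ring
    have : 0 ≤ (t * |b * g| - |a - b|) ^ 2 / t := by positivity
    rw [abs_mul, abs_mul, abs_two]
    linarith
  have h2 : |(a - b) ^ 2 * g| ≤ (a - b) ^ 2 := by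
    rw [abs_mul, abs_of_nonneg (sq_nonneg (a - b))]
    exact mul_le_of_le_one_right (sq_nonneg _) hg
  rw [e, ← hq]
  refine (abs_add_le _ _).trans ?_
  nlinarith

/-- Centre f at its `Q`-mean, which leaves the difference unchanged, and integrate `abs_sub_mul_le`:
the q-weighted square becomes the variance under `Q`, and ∫(√p − √q)² = 2H² doubles the coefficient
1/t + 1. -/
theorem abs_integral_kernel_sub_le (P Q : Model S A ν) (x : S × A) {f : S → ℝ}
    (hf : Measurable f) (hf1 : ∀ y, f y ∈ Set.Icc (0 : ℝ) 1) {t : ℝ} (ht : 0 < t) :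
    |∫ y, f y ∂(P.kernel x) - ∫ y, f y ∂(Q.kernel x)| ≤
      t * variance f (Q.kernel x) + (2 / t + 2) * (hellingerSq P Q x).toReal := by
  set c := ∫ y, f y ∂(Q.kernel x) with hc
  have habs : ∀ y, |f y| ≤ 1 := fun y => abs_le.2 ⟨by linarith [(hf1 y).1], (hf1 y).2⟩
  have hc0 : 0 ≤ c := integral_nonneg fun y => (hf1 y).1
  have hc1 : c ≤ 1 := (le_abs_self _).trans (abs_integral_le_of_abs_le habs)
  have hg : ∀ y, |f y - c| ≤ 1 := fun y =>
    abs_le.2 ⟨by linarith [(hf1 y).1], by linarith [(hf1 y).2]⟩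
  have hgm : Measurable fun y => f y - c := hf.sub_const c
  have hP := P.integrable_dens_mul x hgm hg
  have hQ := Q.integrable_dens_mul x hgm hg
  have hdiff : ∫ y, f y ∂(P.kernel x) - c =
      ∫ y, ((P.dens x y : ℝ) - Q.dens x y) * (f y - c) ∂ν := by
    have h1 : ∫ y, (f y - c) ∂(P.kernel x) = ∫ y, f y ∂(P.kernel x) - c := by
      rw [integral_sub (integrable_of_abs_le hf habs) (integrable_const _)]; simp
    have h2 : ∫ y, (f y - c) ∂(Q.kernel x) = 0 := by
      rw [integral_sub (integrable_of_abs_le hf habs) (integrable_const _)]; simp [hc]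
    rw [P.integral_kernel] at h1
    rw [Q.integral_kernel] at h2
    simp_rw [sub_mul]
    rw [integral_sub hP hQ, h1, h2, sub_zero]
  have hsq : ∀ y, |(f y - c) ^ 2| ≤ 1 := fun y => by
    rw [abs_pow]; exact pow_le_one₀ (abs_nonneg _) (hg y)
  have hQ2 := Q.integrable_dens_mul x (hgm.pow_const 2) hsq
  rw [hdiff, variance_eq_integral hf.aemeasurable, ← hc, Q.integral_kernel, toReal_hellingerSq]
  have hmono := integral_mono_of_nonneg (μ := ν)
    (f := fun y => |((P.dens x y : ℝ) - Q.dens x y) * (f y - c)|)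
    (.of_forall fun y => abs_nonneg _)
    ((hQ2.const_mul t).add ((integrable_sqrt_dens_sub_sq P Q x).const_mul (1 / t + 1)))
    (.of_forall fun y => abs_sub_mul_le (P.dens x y) (Q.dens x y) (hg y) ht)
  refine abs_integral_le_integral_abs.trans (hmono.trans (le_of_eq ?_))
  simp only [Pi.add_apply]
  rw [integral_add (hQ2.const_mul t) ((integrable_sqrt_dens_sub_sq P Q x).const_mul _),
    integral_const_mul, integral_const_mul]
  ring

theorem memLp_two_of_abs_le {α : Type*} [MeasurableSpace α] {μ : Measure α} [IsFiniteMeasure μ]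
    {f : α → ℝ} (hf : Measurable f) {M : ℝ} (hM : ∀ x, |f x| ≤ M) : MemLp f 2 μ :=
  MemLp.of_bound hf.aestronglyMeasurable M (.of_forall hM)

theorem variance_le_one {α : Type*} [MeasurableSpace α] {μ : Measure α} [IsProbabilityMeasure μ]
    {f : α → ℝ} (hf : Measurable f) (hM : ∀ x, |f x| ≤ 1) : variance f μ ≤ 1 := by
  rw [variance_eq_sub (memLp_two_of_abs_le hf hM)]
  have h : |∫ x, f x ^ 2 ∂μ| ≤ 1 := abs_integral_le_of_abs_le fun x => by
    rw [abs_pow]; exact pow_le_one₀ (abs_nonneg _) (hM x)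
  have := (abs_le.1 h).2
  simp only [Pi.pow_apply]
  nlinarith [sq_nonneg (∫ x, f x ∂μ)]

theorem abs_variance_le_one {α : Type*} [MeasurableSpace α] {μ : Measure α}
    [IsProbabilityMeasure μ] {f : α → ℝ} (hf : Measurable f) (hM : ∀ x, |f x| ≤ 1) :
    |variance f μ| ≤ 1 := by
  rw [abs_of_nonneg (variance_nonneg _ _)]
  exact variance_le_one hf hM

theorem measurable_variance_kernel {α β : Type*} [MeasurableSpace α] [MeasurableSpace β]
    (κ : Kernel α β) [IsMarkovKernel κ] {f : β → ℝ} (hf : Measurable f) {M : ℝ}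
    (hM : ∀ x, |f x| ≤ M) : Measurable fun a => variance f (κ a) := by
  have : (fun a => variance f (κ a)) =
      fun a => ∫ b, f b ^ 2 ∂(κ a) - (∫ b, f b ∂(κ a)) ^ 2 := by
    ext a
    rw [variance_eq_sub (memLp_two_of_abs_le hf hM)]
    rfl
  rw [this]
  exact (measurable_integral_kernel κ (hf.pow_const 2)).sub
    ((measurable_integral_kernel κ hf).pow_const 2)

/-- Parallelogram law for variances, with the variance of f − g discarded. -/
theorem variance_add_le {α : Type*} [MeasurableSpace α] {μ : Measure α} [IsProbabilityMeasure μ]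
    {f g : α → ℝ} (hf : MemLp f 2 μ) (hg : MemLp g 2 μ) :
    variance (f + g) μ ≤ 2 * variance f μ + 2 * variance g μ := by
  have h1 := variance_add hf hg
  have h2 := variance_sub hf hg
  have h3 := variance_nonneg (f - g) μ
  linarith

/-- The one-step model error `|(P - Q) V^π_{h+1;P}|` along the policy `π`. -/
noncomputable def stepError (r : S × A → ℝ) (H : ℕ) (P Q : Model S A ν) (π : Policy S A) (h : ℕ)
    (s : S) : ℝ :=
  |∫ s', value r H P π (h + 1) s' ∂(stepKernel P π h s) -
    ∫ s', value r H P π (h + 1) s' ∂(stepKernel Q π h s)|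

variable {r : S × A → ℝ} {H : ℕ} {P Q : Model S A ν} {π : Policy S A}

theorem measurable_stepError (hrm : Measurable r) (h : ℕ) :
    Measurable (stepError r H P Q π h) :=
  ((measurable_integral_kernel _ (measurable_value hrm H P π _)).sub
    (measurable_integral_kernel _ (measurable_value hrm H P π _))).abs

theorem integral_mem_Icc {α : Type*} [MeasurableSpace α] {μ : Measure α} [IsProbabilityMeasure μ]
    {f : α → ℝ} (hf : ∀ x, f x ∈ Set.Icc (0 : ℝ) 1) : ∫ x, f x ∂μ ∈ Set.Icc (0 : ℝ) 1 :=
  ⟨integral_nonneg fun x => (hf x).1, (le_abs_self _).trans (abs_integral_le_of_abs_le fun x => by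
    rw [abs_of_nonneg (hf x).1]; exact (hf x).2)⟩

theorem abs_stepError_le (hV : ∀ h s, value r H P π h s ∈ Set.Icc (0 : ℝ) 1) (h : ℕ) (s : S) :
    |stepError r H P Q π h s| ≤ 1 := by
  have h1 := integral_mem_Icc (μ := stepKernel P π h s) (hV (h + 1))
  have h2 := integral_mem_Icc (μ := stepKernel Q π h s) (hV (h + 1))
  rw [stepError, abs_abs, abs_le]
  constructor <;> linarith [h1.1, h1.2, h2.1, h2.2]

theorem abs_le_one_of_mem_Icc {a : ℝ} (ha : a ∈ Set.Icc (0 : ℝ) 1) : |a| ≤ 1 := by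
  rw [abs_of_nonneg ha.1]; exact ha.2

theorem abs_sub_le_one_of_mem_Icc {a b : ℝ} (ha : a ∈ Set.Icc (0 : ℝ) 1)
    (hb : b ∈ Set.Icc (0 : ℝ) 1) : |a - b| ≤ 1 :=
  abs_le.2 ⟨by linarith [ha.1, hb.2], by linarith [ha.2, hb.1]⟩

/-- A simulation lemma, together with a bound on the total variance of the value difference. -/
theorem value_sub_sq_add_expSum_le (hrm : Measurable r) (hr : ∀ x, r x ∈ Set.Icc (0 : ℝ) 1)
    (hV : ∀ h s, value r H P π h s ∈ Set.Icc (0 : ℝ) 1)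
    (hU : ∀ h s, value r H Q π h s ∈ Set.Icc (0 : ℝ) 1) (n h : ℕ) (hn : h + n = H) (s : S) :
    |value r H P π h s - value r H Q π h s| ≤ expSum Q π (stepError r H P Q π) n h s ∧
      expSum Q π (fun h s => variance (value r H P π (h + 1) - value r H Q π (h + 1))
          (stepKernel Q π h s)) n h s + (value r H P π h s - value r H Q π h s) ^ 2 ≤
        2 * expSum Q π (stepError r H P Q π) n h s := by
  induction n generalizing h s with
  | zero =>
    rw [value_of_le (by omega), value_of_le (by omega)]
    simp [expSum]
  | succ n ih =>
    have hlt : h < H := by omega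
    have hVm := measurable_value hrm H P π
    have hUm := measurable_value hrm H Q π
    have ihs := ih (h + 1) (by omega)
    have hB := integrable_expSum Q π (measurable_stepError (H := H) (P := P) (Q := Q) (π := π) hrm)
      (abs_stepError_le hV) n (h + 1) (stepKernel Q π h s)
    have hΔb : ∀ h s, |(value r H P π h - value r H Q π h) s| ≤ 1 := fun h s =>
      abs_sub_le_one_of_mem_Icc (hV h s) (hU h s)
    have hΔm : ∀ h, Measurable (value r H P π h - value r H Q π h) := fun h =>
      (hVm h).sub (hUm h)
    have hΔ : Integrable (value r H P π (h + 1) - value r H Q π (h + 1)) (stepKernel Q π h s) :=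
      integrable_of_abs_le (hΔm _) (hΔb _)
    have hΔ2 : Integrable (fun s' => (value r H P π (h + 1) s' - value r H Q π (h + 1) s') ^ 2)
        (stepKernel Q π h s) := by
      refine integrable_of_abs_le ((hΔm (h + 1)).pow_const 2) (M := 1) fun s' => ?_
      rw [abs_pow]; exact pow_le_one₀ (abs_nonneg _) (hΔb _ _)
    have hvar := integrable_expSum Q π
      (F := fun h s => variance (value r H P π (h + 1) - value r H Q π (h + 1))
        (stepKernel Q π h s))
      (fun h => measurable_variance_kernel (stepKernel Q π h) (hΔm (h + 1)) (hΔb (h + 1)))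
      (M := 1) (fun h s => abs_variance_le_one (hΔm (h + 1)) (hΔb (h + 1))) n (h + 1)
      (stepKernel Q π h s)
    set m := ∫ s', (value r H P π (h + 1) - value r H Q π (h + 1)) s' ∂(stepKernel Q π h s) with hm
    set D := value r H P π h s - value r H Q π h s with hD
    -- The reward cancels between the two Bellman equations, leaving D − m = (P − Q)V_P.
    have hDm : |D - m| = stepError r H P Q π h s := by
      rw [stepError, hD, hm, value_of_lt hrm hr hlt, value_of_lt hrm hr hlt]
      simp only [Pi.sub_apply]
      rw [integral_sub (integrable_of_abs_le (hVm _) fun s' => abs_le_one_of_mem_Icc (hV _ s'))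
        (integrable_of_abs_le (hUm _) fun s' => abs_le_one_of_mem_Icc (hU _ s'))]
      congr 1
      ring
    have hm1 : |m| ≤ 1 := abs_integral_le_of_abs_le (hΔb _)
    have hD1 : |D| ≤ 1 := hΔb h s
    simp only [expSum]
    constructor
    · have h1 : |m| ≤ ∫ s', expSum Q π (stepError r H P Q π) n (h + 1) s'
          ∂(stepKernel Q π h s) :=
        abs_integral_le_integral_abs.trans (integral_mono hΔ.abs hB fun s' => (ihs s').1)
      have h2 : |D| ≤ |D - m| + |m| := by simpa using abs_add_le (D - m) m
      linarith
    · have h1 := integral_mono (hvar.add hΔ2) (hB.const_mul 2) fun s' => (ihs s').2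
      simp only [Pi.add_apply] at h1
      rw [integral_add hvar hΔ2, integral_const_mul] at h1
      -- The variance is E[Δ²] − m² for Δ the next value difference. The induction hypothesis
      -- absorbs E[Δ²], and D² − m² costs only twice the step error: this is why D² is carried in
      -- the statement.
      have h2 : variance (value r H P π (h + 1) - value r H Q π (h + 1)) (stepKernel Q π h s) =
          ∫ s', (value r H P π (h + 1) s' - value r H Q π (h + 1) s') ^ 2 ∂(stepKernel Q π h s) -
            m ^ 2 := by
        rw [variance_eq_sub (memLp_two_of_abs_le (hΔm _) (hΔb _))]
        rfl
      have h3 : D ^ 2 - m ^ 2 ≤ 2 * |D - m| := by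
        have : D ^ 2 - m ^ 2 ≤ |D - m| * |D + m| := by
          rw [← abs_mul]
          refine le_trans (le_of_eq ?_) (le_abs_self _)
          ring
        have h4 : |D + m| ≤ 2 := (abs_add_le D m).trans (by linarith)
        nlinarith [abs_nonneg (D - m)]
      rw [h2]
      linarith

/-- Self-bounding argument: one fixed t removes b from the bound on X, then a t of order √(e/(v +
e)) balances the two terms. -/
theorem le_sqrt_mul_add_of_forall_pos {b v X y e : ℝ} (hv : 0 ≤ v) (he : 0 ≤ e)
    (h : ∀ t, 0 < t → b ≤ t * X + (2 / t + 2) * e) (hX : X ≤ 2 * v + 2 * y) (hy : y ≤ 2 * b) :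
    b ≤ 152 * (√(e * v) + e) := by
  -- Since X ≤ 2v + 4b, t = 1/8 gives b ≤ v/4 + b/2 + 18e, hence b ≤ v/2 + 36e.
  have h8 := h (1 / 8) (by norm_num)
  norm_num at h8
  have hX' : X ≤ 4 * v + 144 * e := by linarith
  rcases he.eq_or_lt with rfl | he
  · simp only [mul_zero, add_zero, zero_mul, Real.sqrt_zero] at h hX' ⊢
    by_contra! hb
    -- For e = 0 the balancing t would vanish; a small t proportional to b gives b < b instead.
    have h1 := h (b / (8 * (v + 1))) (by positivity)
    have h2 : b / (8 * (v + 1)) * X ≤ b / (8 * (v + 1)) * (4 * v) := by gcongr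
    have h3 : b / (8 * (v + 1)) * (4 * v) < b := by
      rw [div_mul_eq_mul_div, div_lt_iff₀ (by positivity)]
      nlinarith
    linarith
  · set a := √e with ha
    set w := √(v + e) with hw
    have ha0 : 0 < a := Real.sqrt_pos.2 he
    have hw0 : 0 < w := Real.sqrt_pos.2 (by linarith)
    have ha2 : a ^ 2 = e := Real.sq_sqrt he.le
    have hw2 : w ^ 2 = v + e := Real.sq_sqrt (by linarith)
    have haw : a ≤ w := Real.sqrt_le_sqrt (by linarith)
    -- The balancing choice; using v + e rather than v keeps t ≤ 1 and avoids dividing by zero when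
    -- v = 0.
    have h1 := h (a / w) (by positivity)
    have hwle : a * w ≤ √(e * v) + e := by
      have : w ≤ √v + a := Real.sqrt_le_iff.2 ⟨by positivity, by
        nlinarith [Real.sq_sqrt hv, mul_nonneg (Real.sqrt_nonneg v) ha0.le]⟩
      rw [Real.sqrt_mul he.le, ← ha]
      nlinarith
    have e1 : 2 / (a / w) * e = 2 * (a * w) := by
      rw [← ha2]; field_simp
    have e2 : a / w * X ≤ 4 * (a * w) + 140 * e := by
      have h3 : a / w * X ≤ a / w * (4 * w ^ 2 + 140 * e) := by
        gcongr; linarith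
      have h4 : a / w * (4 * w ^ 2) = 4 * (a * w) := by field_simp
      have h5 : a / w * (140 * e) ≤ 1 * (140 * e) := by
        gcongr
        exact (div_le_one hw0).2 haw
      linarith
    have := Real.sqrt_nonneg (e * v)
    linarith

/-- Second-order simulation lemma: the value gap is controlled by the variance of the return under
`Q` and the total squared Hellinger error along the trajectories of `π` in `Q`. -/
theorem abs_value_sub_le (hrm : Measurable r) (hr : ∀ x, r x ∈ Set.Icc (0 : ℝ) 1)
    (hV : ∀ h s, value r H P π h s ∈ Set.Icc (0 : ℝ) 1)
    (hU : ∀ h s, value r H Q π h s ∈ Set.Icc (0 : ℝ) 1) (s : S) :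
    |value r H P π 0 s - value r H Q π 0 s| ≤
      152 * (√(expSum Q π (fun h s => (hellingerSq P Q (s, π.act h s)).toReal) H 0 s *
        returnVar r H Q π s) +
        expSum Q π (fun h s => (hellingerSq P Q (s, π.act h s)).toReal) H 0 s) := by
  have hVm := measurable_value hrm H P π
  have hUm := measurable_value hrm H Q π
  have hVb : ∀ h s, |value r H P π h s| ≤ 1 := fun h s => abs_le_one_of_mem_Icc (hV h s)
  have hUb : ∀ h s, |value r H Q π h s| ≤ 1 := fun h s => abs_le_one_of_mem_Icc (hU h s)
  have hΔb : ∀ h s, |(value r H P π h - value r H Q π h) s| ≤ 1 := fun h s =>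
    abs_sub_le_one_of_mem_Icc (hV h s) (hU h s)
  have hΔm : ∀ h, Measurable (value r H P π h - value r H Q π h) := fun h =>
    (hVm h).sub (hUm h)
  have hhm : ∀ h, Measurable fun s => (hellingerSq P Q (s, π.act h s)).toReal := fun h =>
    ((measurable_hellingerSq P Q).comp (measurable_id.prodMk (π.measurable_act h))).ennreal_toReal
  have hhb : ∀ (h : ℕ) s, |(hellingerSq P Q (s, π.act h s)).toReal| ≤ 1 := fun h s => by
    rw [abs_of_nonneg ENNReal.toReal_nonneg]; exact toReal_hellingerSq_le_one _ _ _
  have hvarm : ∀ (f : ℕ → S → ℝ), (∀ h, Measurable (f h)) → (∀ h s, |f h s| ≤ 1) → ∀ h,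
      Measurable fun s => variance (f (h + 1)) (stepKernel Q π h s) := fun f hf hb h =>
    measurable_variance_kernel _ (hf _) (hb _)
  have hvarb : ∀ (f : ℕ → S → ℝ), (∀ h, Measurable (f h)) → (∀ h s, |f h s| ≤ 1) → ∀ h s,
      |variance (f (h + 1)) (stepKernel Q π h s)| ≤ 1 := fun f hf hb h s =>
    abs_variance_le_one (hf _) (hb _)
  obtain ⟨h1, h2⟩ := value_sub_sq_add_expSum_le hrm hr hV hU H 0 (by omega) s
  refine h1.trans ?_
  refine le_sqrt_mul_add_of_forall_pos
    (X := expSum Q π (fun h s => variance (value r H P π (h + 1)) (stepKernel Q π h s)) H 0 s)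
    (y := expSum Q π (fun h s => variance (value r H P π (h + 1) - value r H Q π (h + 1))
      (stepKernel Q π h s)) H 0 s) (variance_nonneg _ _)
    (expSum_nonneg Q π (fun h s => ENNReal.toReal_nonneg) _ _ _) (fun t ht => ?_) ?_ ?_
  · refine expSum_le_combination Q π (measurable_stepError hrm) (hvarm _ hVm hVb) hhm
      (abs_stepError_le hV) (hvarb _ hVm hVb) hhb (fun h s => ?_) H 0 s
    simp only [stepError, stepKernel_apply]
    exact abs_integral_kernel_sub_le P Q _ (hVm _) (hV _) ht
  -- Split V_P = V_Q + (V_P − V_Q) inside each one-step variance.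
  · rw [returnVar_eq_expSum hrm hr]
    refine expSum_le_combination Q π (hvarm _ hVm hVb) (hvarm _ hUm hUb)
      (hvarm (fun h => value r H P π h - value r H Q π h) hΔm hΔb)
      (hvarb _ hVm hVb) (hvarb _ hUm hUb)
      (hvarb (fun h => value r H P π h - value r H Q π h) hΔm hΔb) (fun h s => ?_) H 0 s
    have := variance_add_le (memLp_two_of_abs_le (μ := stepKernel Q π h s) (hUm (h + 1))
      (hUb (h + 1))) (memLp_two_of_abs_le (hΔm (h + 1)) (hΔb (h + 1)))
    rwa [add_sub_cancel] at this
  · linarith [sq_nonneg (value r H P π 0 s - value r H Q π 0 s)]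

theorem sum_lintegral_occupancy (P Q : Model S A ν) (π : Policy S A) (H : ℕ) (s : S) :
    ∑ h : Fin H, ∫⁻ x, hellingerSq P Q x ∂(occupancy H Q π s h) =
      ENNReal.ofReal
        (expSum Q π (fun h s => (hellingerSq P Q (s, π.act h s)).toReal) H 0 s) := by
  have hhm : ∀ h, Measurable fun s => (hellingerSq P Q (s, π.act h s)).toReal := fun h =>
    ((measurable_hellingerSq P Q).comp (measurable_id.prodMk (π.measurable_act h))).ennreal_toReal
  rw [← sum_lintegral_trajKernel Q π hhm (fun h s => ENNReal.toReal_nonneg) (M := 1)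
    (fun h s => by
      rw [abs_of_nonneg ENNReal.toReal_nonneg]; exact toReal_hellingerSq_le_one _ _ _)]
  refine Finset.sum_congr rfl fun h _ => ?_
  rw [occupancy, lintegral_map (measurable_hellingerSq P Q)
    ((measurable_pi_apply _).prodMk ((π.measurable_act _).comp (measurable_pi_apply _)))]
  simp [ENNReal.ofReal_toReal (hellingerSq_ne_top _ _ _)]

end Simulation
end OfflineRL

namespace OfflineRL

/-! ### Likelihood ratios and the version space on a good data set -/

section Likelihood

variable {S A : Type*} [MeasurableSpace S] [MeasurableSpace A] {ν : Measure S} [SigmaFinite ν]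

/-- The likelihood ratio factor `exp(H²(P(x) ‖ Q(x))) · √(P(y | x) / Q(y | x))`. -/
noncomputable def hellingerRatio (P Q : Model S A ν) (x : S × A) (y : S) : ℝ :=
  Real.exp (hellingerSq P Q x).toReal * √((P.dens x y : ℝ) / Q.dens x y)

theorem hellingerRatio_nonneg (P Q : Model S A ν) (x : S × A) (y : S) :
    0 ≤ hellingerRatio P Q x y := by
  unfold hellingerRatio; positivity

theorem measurable_hellingerRatio (P Q : Model S A ν) :
    Measurable fun z : (S × A) × S => hellingerRatio P Q z.1 z.2 := by
  unfold hellingerRatio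
  exact ((measurable_hellingerSq P Q).ennreal_toReal.comp measurable_fst).exp.mul
    (P.measurable_dens.coe_nnreal_real.div Q.measurable_dens.coe_nnreal_real).sqrt

theorem Model.lintegral_kernel (P : Model S A ν) (x : S × A) {f : S → ℝ≥0∞} (hf : Measurable f) :
    ∫⁻ y, f y ∂(P.kernel x) = ∫⁻ y, (P.dens x y : ℝ≥0∞) * f y ∂ν := by
  rw [P.kernel_apply, lintegral_withDensity_eq_lintegral_mul _
    (P.measurable_dens_apply x).coe_nnreal_ennreal hf]
  rfl

/-- The Hellinger affinity ∫√(pq) equals 1 − H², which is at most exp(−H²). -/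
theorem lintegral_hellingerRatio_le_one (P Q : Model S A ν) (x : S × A) :
    ∫⁻ y, ENNReal.ofReal (hellingerRatio P Q x y) ∂(Q.kernel x) ≤ 1 := by
  have hm : Measurable fun y => ENNReal.ofReal (hellingerRatio P Q x y) :=
    ((measurable_hellingerRatio P Q).comp measurable_prodMk_left).ennreal_ofReal
  set h := (hellingerSq P Q x).toReal with hh
  have hi : Integrable (fun y => Real.exp h * (2⁻¹ * ((P.dens x y : ℝ) + Q.dens x y -
      (√(P.dens x y : ℝ) - √(Q.dens x y : ℝ)) ^ 2))) ν :=
    ((((P.integrable_dens x).add (Q.integrable_dens x)).sub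
      (integrable_sqrt_dens_sub_sq P Q x)).const_mul _).const_mul _
  have hle : ∀ y, (Q.dens x y : ℝ≥0∞) * ENNReal.ofReal (hellingerRatio P Q x y) ≤
      ENNReal.ofReal (Real.exp h * (2⁻¹ * ((P.dens x y : ℝ) + Q.dens x y -
      (√(P.dens x y : ℝ) - √(Q.dens x y : ℝ)) ^ 2))) := fun y => by
    rw [← ENNReal.ofReal_coe_nnreal, ← ENNReal.ofReal_mul NNReal.zero_le_coe]
    refine ENNReal.ofReal_le_ofReal ?_
    have hp := Real.sq_sqrt (P.dens x y).coe_nonneg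
    have hq := Real.sq_sqrt (Q.dens x y).coe_nonneg
    rw [hellingerRatio, Real.sqrt_div NNReal.zero_le_coe, ← hh]
    have e : (Q.dens x y : ℝ) * (√(P.dens x y : ℝ) / √(Q.dens x y : ℝ)) =
        √(P.dens x y : ℝ) * √(Q.dens x y : ℝ) := by
      rcases eq_or_ne (√(Q.dens x y : ℝ)) 0 with h0 | h0
      · simp [h0]
      · field_simp
        rw [hq, mul_comm]
    refine le_of_eq ?_
    calc (Q.dens x y : ℝ) * (Real.exp h * (√(P.dens x y : ℝ) / √(Q.dens x y : ℝ)))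
        = Real.exp h * ((Q.dens x y : ℝ) * (√(P.dens x y : ℝ) / √(Q.dens x y : ℝ))) := by ring
      _ = _ := by rw [e]; congr 1; linarith
  rw [Q.lintegral_kernel x hm]
  refine (lintegral_mono hle).trans ?_
  have hadd : Integrable (fun y => (P.dens x y : ℝ) + Q.dens x y) ν :=
    (P.integrable_dens x).add (Q.integrable_dens x)
  rw [← ofReal_integral_eq_lintegral_ofReal hi, integral_const_mul, integral_const_mul,
    integral_sub hadd (integrable_sqrt_dens_sub_sq P Q x),
    integral_add (P.integrable_dens x) (Q.integrable_dens x), P.integral_dens, Q.integral_dens]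
  · rw [← ENNReal.ofReal_one]
    refine ENNReal.ofReal_le_ofReal ?_
    have e : 2⁻¹ * (1 + 1 - ∫ y, (√(P.dens x y : ℝ) - √(Q.dens x y : ℝ)) ^ 2 ∂ν) = 1 - h := by
      rw [hh, toReal_hellingerSq]; ring
    rw [e]
    have h1 := Real.add_one_le_exp (-h)
    calc Real.exp h * (1 - h) ≤ Real.exp h * Real.exp (-h) := by gcongr; linarith
      _ = 1 := by rw [← Real.exp_add]; simp
  · refine .of_forall fun y => ?_
    have := sqrt_sub_sqrt_sq_le (P.dens x y) (Q.dens x y)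
    have h2 : 0 ≤ (P.dens x y : ℝ) + Q.dens x y -
      (√(P.dens x y : ℝ) - √(Q.dens x y : ℝ)) ^ 2 := by linarith
    simp only [Pi.zero_apply]
    positivity

/-- The likelihood of a data set under a model. -/
noncomputable def likelihood {H K : ℕ} (P : Model S A ν) (D : Dataset S A H K) : ℝ≥0 :=
  ∏ k : Fin K, ∏ h : Fin H, P.dens (D.state k h.castSucc, D.action k h) (D.state k h.succ)

theorem ennreal_log_prod {ι : Type*} (s : Finset ι) (f : ι → ℝ≥0∞) :
    ENNReal.log (∏ i ∈ s, f i) = ∑ i ∈ s, ENNReal.log (f i) := by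
  classical
  induction s using Finset.induction_on with
  | empty => simp
  | insert a s ha ih => rw [Finset.prod_insert ha, Finset.sum_insert ha, ENNReal.log_mul_add, ih]

theorem logLik_eq_log_likelihood {H K : ℕ} (P : Model S A ν) (D : Dataset S A H K) :
    logLik P D = ENNReal.log (likelihood P D) := by
  simp [logLik, likelihood, ennreal_log_prod]

/-- The product of the factors `hellingerRatio` over all transitions of a data set. -/
noncomputable def likelihoodRatio {H K : ℕ} (P Q : Model S A ν) (D : Dataset S A H K) : ℝ :=
  ∏ k : Fin K, ∏ h : Fin H,
    hellingerRatio P Q (D.state k h.castSucc, D.action k h) (D.state k h.succ)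

theorem likelihoodRatio_eq {H K : ℕ} (P Q : Model S A ν) (D : Dataset S A H K) :
    likelihoodRatio P Q D =
      Real.exp (∑ k : Fin K, ∑ h : Fin H,
        (hellingerSq P Q (D.state k h.castSucc, D.action k h)).toReal) *
          √((likelihood P D : ℝ) / likelihood Q D) := by
  have hs : ∀ {n : ℕ} (f : Fin n → ℝ), (∀ i, 0 ≤ f i) → √(∏ i, f i) = ∏ i, √(f i) :=
    fun f hf => by
      simp_rw [Real.sqrt_eq_rpow]
      exact (Real.finsetProd_rpow _ _ (fun i _ => hf i) _).symm
  simp only [likelihoodRatio, hellingerRatio, Finset.prod_mul_distrib, Real.exp_sum, likelihood]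
  push_cast
  simp_rw [← Finset.prod_div_distrib]
  rw [hs _ fun k => Finset.prod_nonneg fun h _ => by positivity]
  congr 2
  ext k
  rw [hs _ fun h => by positivity]

/-- On a data set where every `likelihoodRatio` is less than `exp L`, the true model is
in the version space and every model in the version space has Hellinger error at most `3 L`. -/
theorem mem_versionSpace_and_sum_hellingerSq_le {H K : ℕ} {ℳ : Finset (Model S A ν)}
    {Q : Model S A ν} (hQ : Q ∈ ℳ) (D : Dataset S A H K) {L : ℝ} (hL : 0 ≤ L)
    (hpos : 0 < likelihood Q D)
    (h : ∀ P ∈ ℳ, likelihoodRatio P Q D < Real.exp L) :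
    Q ∈ versionSpace ℳ (4 * L) D ∧ ∀ P ∈ versionSpace ℳ (4 * L) D,
      ∑ k : Fin K, ∑ h : Fin H,
        (hellingerSq P Q (D.state k h.castSucc, D.action k h)).toReal ≤ 3 * L := by
  have hlog : ∀ P : Model S A ν, 0 < likelihood P D → logLik P D = (Real.log (likelihood P D) : ℝ) :=
    fun P hP => by rw [logLik_eq_log_likelihood, ENNReal.log_of_nnreal hP.ne']
  have hlog0 : ∀ P : Model S A ν, likelihood P D = 0 → logLik P D = ⊥ := fun P hP => by
    rw [logLik_eq_log_likelihood, hP]; simp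
  -- Logarithm of the ratio bound: ∑H² + (log P − log Q)/2 < L. Dropping ∑H² puts `Q` within 2L ≤ 4L
  -- of the maximum; inserting log P ≥ log Q − 4L gives ∑H² < 3L.
  have key : ∀ P ∈ ℳ, 0 < likelihood P D →
      ∑ k : Fin K, ∑ h : Fin H,
        (hellingerSq P Q (D.state k h.castSucc, D.action k h)).toReal +
        (Real.log (likelihood P D) - Real.log (likelihood Q D)) / 2 < L := fun P hP hP0 => by
    have h1 := h P hP
    rw [likelihoodRatio_eq] at h1
    have hP0' : (0 : ℝ) < likelihood P D := hP0
    have hQ0' : (0 : ℝ) < likelihood Q D := hpos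
    have h2 : √((likelihood P D : ℝ) / likelihood Q D) =
        Real.exp ((Real.log (likelihood P D) - Real.log (likelihood Q D)) / 2) := by
      rw [← Real.log_div hP0'.ne' hQ0'.ne', Real.exp_half, Real.exp_log (by positivity)]
    rw [h2, ← Real.exp_add, Real.exp_lt_exp] at h1
    exact h1
  have hsum : ∀ P : Model S A ν, 0 ≤ ∑ k : Fin K, ∑ h : Fin H,
      (hellingerSq P Q (D.state k h.castSucc, D.action k h)).toReal := fun P =>
    Finset.sum_nonneg fun k _ => Finset.sum_nonneg fun h _ => ENNReal.toReal_nonneg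
  refine ⟨⟨hQ, EReal.sub_le_of_le_add (iSup₂_le fun P hP => ?_)⟩, fun P hP => ?_⟩
  · rcases eq_or_ne (likelihood P D) 0 with h0 | h0
    · rw [hlog0 P h0]; exact bot_le
    · have h0' : 0 < likelihood P D := pos_iff_ne_zero.2 h0
      have := key P hP h0'
      have := hsum P
      rw [hlog P h0', hlog Q hpos]
      norm_cast
      linarith
  · have h1 : logLik Q D - ((4 * L : ℝ) : EReal) ≤ logLik P D :=
      (EReal.sub_le_sub (le_iSup₂ (f := fun P _ => logLik P D) Q hQ) le_rfl).trans hP.2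
    rw [hlog Q hpos] at h1
    rcases eq_or_ne (likelihood P D) 0 with h0 | h0
    · rw [hlog0 P h0] at h1
      norm_cast at h1
    · have h0' : 0 < likelihood P D := pos_iff_ne_zero.2 h0
      rw [hlog P h0'] at h1
      norm_cast at h1
      have := key P hP.1 h0'
      linarith

end Likelihood

/-! ### Adaptive data: the supermartingale bound and the good event -/

section Data

/-- The identity on rectangles determines the joint law of (ι, Y) as a composition-product, so it
extends to all nonnegative measurable integrands. -/
theorem lintegral_eq_lintegral_kernel_of_transition {Ω Ω' X S : Type*} [MeasurableSpace Ω]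
    [MeasurableSpace Ω'] [MeasurableSpace X] [MeasurableSpace S] {μ : Measure Ω}
    [IsProbabilityMeasure μ] {ι : Ω → Ω'} (hι : Measurable ι) {x : Ω' → X} (hx : Measurable x)
    {Y : Ω → S} (hY : Measurable Y) (κ : Kernel X S) [IsMarkovKernel κ]
    (htr : ∀ (B : Set S), MeasurableSet B → ∀ G : Set Ω', MeasurableSet G →
      μ (ι ⁻¹' G ∩ Y ⁻¹' B) = ∫⁻ ω in ι ⁻¹' G, κ (x (ι ω)) B ∂μ)
    {g : Ω' × S → ℝ≥0∞} (hg : Measurable g) :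
    ∫⁻ ω, g (ι ω, Y ω) ∂μ = ∫⁻ ω, ∫⁻ y, g (ι ω, y) ∂(κ (x (ι ω))) ∂μ := by
  have hprob : IsProbabilityMeasure (μ.map ι) :=
    Measure.isProbabilityMeasure_map hι.aemeasurable
  have hmap : μ.map (fun ω => (ι ω, Y ω)) = (μ.map ι) ⊗ₘ (κ.comap x hx) := by
    have : IsFiniteMeasure (μ.map fun ω => (ι ω, Y ω)) := inferInstance
    refine Measure.ext_prod fun {G B} hG hB => ?_
    rw [Measure.map_apply (hι.prodMk hY) (hG.prod hB), Measure.compProd_apply_prod hG hB,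
      setLIntegral_map hG (Kernel.measurable_coe _ hB) hι]
    exact htr B hB G hG
  rw [← lintegral_map hg (hι.prodMk hY), hmap, Measure.lintegral_compProd hg,
    lintegral_map (Measurable.lintegral_kernel_prod_right' hg) hι]
  rfl

variable {S A Ω : Type*} [MeasurableSpace S] [MeasurableSpace A]

section History

variable {H K : ℕ} (D : Ω → Dataset S A H K)

theorem measurable_state_history_of_lt {i k : Fin K} (hi : i < k) (h : Fin H) (j : Fin (H + 1)) :
    Measurable[history D k h] fun ω => (D ω).state i j := by
  refine measurable_iff_comap_le.2 (le_sup_of_le_left (le_sup_of_le_left (le_sup_of_le_left ?_)))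
  exact le_iSup₂_of_le i hi (le_iSup_of_le j le_rfl)

theorem measurable_action_history_of_lt {i k : Fin K} (hi : i < k) (h j : Fin H) :
    Measurable[history D k h] fun ω => (D ω).action i j := by
  refine measurable_iff_comap_le.2 (le_sup_of_le_left (le_sup_of_le_left (le_sup_of_le_right ?_)))
  exact le_iSup₂_of_le i hi (le_iSup_of_le j le_rfl)

theorem measurable_state_history_of_le (k : Fin K) {h : Fin H} {j : Fin (H + 1)}
    (hj : j ≤ h.castSucc) : Measurable[history D k h] fun ω => (D ω).state k j := by
  refine measurable_iff_comap_le.2 (le_sup_of_le_left (le_sup_of_le_right ?_))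
  exact le_iSup₂_of_le j hj le_rfl

theorem measurable_action_history_of_le (k : Fin K) {h j : Fin H} (hj : j ≤ h) :
    Measurable[history D k h] fun ω => (D ω).action k j := by
  refine measurable_iff_comap_le.2 (le_sup_of_le_right ?_)
  exact le_iSup₂_of_le j hj le_rfl

end History

variable [MeasurableSpace Ω] {ν : Measure S} [SigmaFinite ν] {H K : ℕ} {μ : Measure Ω}
  [IsProbabilityMeasure μ] {Pstar : Model S A ν} {s₀ : S} {D : Ω → Dataset S A H K}

theorem IsOfflineDataset.history_le (hD : IsOfflineDataset μ Pstar s₀ D) (k : Fin K)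
    (h : Fin H) : history D k h ≤ ‹MeasurableSpace Ω› := by
  refine sup_le (sup_le (sup_le ?_ ?_) ?_) ?_
  · exact iSup_le fun i => iSup_le fun _ => iSup_le fun j => (hD.measurable_state i j).comap_le
  · exact iSup_le fun i => iSup_le fun _ => iSup_le fun j => (hD.measurable_action i j).comap_le
  · exact iSup_le fun j => iSup_le fun _ => (hD.measurable_state k j).comap_le
  · exact iSup_le fun j => iSup_le fun _ => (hD.measurable_action k j).comap_le

theorem IsOfflineDataset.lintegral_mul_eq (hD : IsOfflineDataset μ Pstar s₀ D) (k : Fin K)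
    (h : Fin H) {φ : Ω → ℝ≥0∞} (hφ : Measurable[history D k h] φ) {g : (S × A) × S → ℝ≥0∞}
    (hg : Measurable g) :
    ∫⁻ ω, φ ω * g (((D ω).state k h.castSucc, (D ω).action k h), (D ω).state k h.succ) ∂μ =
      ∫⁻ ω, φ ω * ∫⁻ y, g (((D ω).state k h.castSucc, (D ω).action k h), y)
        ∂(Pstar.kernel ((D ω).state k h.castSucc, (D ω).action k h)) ∂μ := by
  have hx : Measurable[history D k h]
      fun ω => ((D ω).state k h.castSucc, (D ω).action k h) :=
    (measurable_state_history_of_le D k le_rfl).prodMk (measurable_action_history_of_le D k le_rfl)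
  have hG : @Measurable (Ω × S) ℝ≥0∞ (@Prod.instMeasurableSpace Ω S (history D k h) _) _
      fun z => φ z.1 * g (((D z.1).state k h.castSucc, (D z.1).action k h), z.2) := by
    let _ : MeasurableSpace Ω := history D k h
    exact (hφ.comp measurable_fst).mul (hg.comp ((hx.comp measurable_fst).prodMk measurable_snd))
  -- Here ι is the identity from Ω with its ambient σ-algebra to Ω with the history σ-algebra.
  refine (@lintegral_eq_lintegral_kernel_of_transition Ω Ω (S × A) S _ (history D k h) _ _ μ _ id
    (measurable_id'' (hD.history_le k h)) _ hx _ (hD.measurable_state k h.succ) Pstar.kernel _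
    (fun B hB G hGm => hD.transition k h B hB G hGm) _ hG).trans ?_
  refine lintegral_congr fun ω => ?_
  exact lintegral_const_mul (φ ω) (f := fun y =>
    g (((D ω).state k h.castSucc, (D ω).action k h), y)) (hg.comp measurable_prodMk_left)

theorem IsOfflineDataset.lintegral_mul_le (hD : IsOfflineDataset μ Pstar s₀ D) (k : Fin K)
    (h : Fin H) {φ : Ω → ℝ≥0∞} (hφ : Measurable[history D k h] φ) {g : (S × A) × S → ℝ≥0∞}
    (hg : Measurable g) (hg1 : ∀ x, ∫⁻ y, g (x, y) ∂(Pstar.kernel x) ≤ 1) :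
    ∫⁻ ω, φ ω * g (((D ω).state k h.castSucc, (D ω).action k h), (D ω).state k h.succ) ∂μ ≤
      ∫⁻ ω, φ ω ∂μ := by
  rw [hD.lintegral_mul_eq k h hφ hg]
  exact lintegral_mono fun ω => mul_le_of_le_one_right' (hg1 _)

/-- Excludes the degenerate case where division by a zero density makes a likelihood ratio 0, so
that its bound carries no information. -/
theorem IsOfflineDataset.ae_dens_pos (hD : IsOfflineDataset μ Pstar s₀ D) (k : Fin K)
    (h : Fin H) : ∀ᵐ ω ∂μ,
      0 < Pstar.dens ((D ω).state k h.castSucc, (D ω).action k h) ((D ω).state k h.succ) := by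
  have hs : MeasurableSet {z : (S × A) × S | Pstar.dens z.1 z.2 = 0} :=
    Pstar.measurable_dens (measurableSet_singleton 0)
  have hx : Measurable fun ω => (((D ω).state k h.castSucc, (D ω).action k h),
      (D ω).state k h.succ) :=
    ((hD.measurable_state k _).prodMk (hD.measurable_action k h)).prodMk (hD.measurable_state k _)
  have hg : Measurable ({z : (S × A) × S | Pstar.dens z.1 z.2 = 0}.indicator
    (fun _ => (1 : ℝ≥0∞))) := measurable_const.indicator hs
  have key := hD.lintegral_mul_eq k h (φ := fun _ => 1) measurable_const hg
  have hz : ∀ x : S × A, ∫⁻ y, {z : (S × A) × S | Pstar.dens z.1 z.2 = 0}.indicator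
      (fun _ => (1 : ℝ≥0∞)) (x, y) ∂(Pstar.kernel x) = 0 := fun x => by
    refine (Pstar.lintegral_kernel x (hg.comp measurable_prodMk_left)).trans ?_
    refine (lintegral_congr fun y => ?_).trans lintegral_zero
    by_cases h0 : Pstar.dens x y = 0 <;> simp [h0]
  simp only [hz, one_mul, mul_zero, lintegral_zero] at key
  replace key := (lintegral_eq_zero_iff (hg.comp hx)).1 key
  filter_upwards [key] with ω hω
  rw [pos_iff_ne_zero]
  intro h0
  simp [Function.comp, h0] at hω

/-- Peel off factors from the latest transition backwards: the remaining ones are functions of the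
history, so integrating out the next state can only increase the bound. No independence of
trajectories is needed. -/
theorem IsOfflineDataset.lintegral_prod_le_one (hD : IsOfflineDataset μ Pstar s₀ D)
    {g : (S × A) × S → ℝ≥0∞} (hg : Measurable g)
    (hg1 : ∀ x, ∫⁻ y, g (x, y) ∂(Pstar.kernel x) ≤ 1) :
    ∫⁻ ω, ∏ k : Fin K, ∏ h : Fin H,
      g (((D ω).state k h.castSucc, (D ω).action k h), (D ω).state k h.succ) ∂μ ≤ 1 := by
  classical
  set Z : Fin K → Fin H → Ω → ℝ≥0∞ := fun k h ω =>
    g (((D ω).state k h.castSucc, (D ω).action k h), (D ω).state k h.succ) with hZ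
  have hZlt : ∀ (k : Fin K) (h : Fin H) (i : Fin K), i < k → ∀ j,
      Measurable[history D k h] (Z i j) := fun k h i hi j =>
    hg.comp (((measurable_state_history_of_lt D hi h _).prodMk
      (measurable_action_history_of_lt D hi h j)).prodMk (measurable_state_history_of_lt D hi h _))
  have hZle : ∀ (k : Fin K) (h j : Fin H), j < h → Measurable[history D k h] (Z k j) :=
    fun k h j hj =>
    hg.comp (((measurable_state_history_of_le D k (Fin.castSucc_le_castSucc_iff.2 hj.le)).prodMk
      (measurable_action_history_of_le D k hj.le)).prodMk
        (measurable_state_history_of_le D k (Fin.succ_le_castSucc_iff.2 hj)))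
  have hins : ∀ {n : ℕ} (m : ℕ) (hm : m < n),
      (Finset.univ.filter fun i : Fin n => (i : ℕ) < m + 1) =
        insert ⟨m, hm⟩ (Finset.univ.filter fun i : Fin n => (i : ℕ) < m) := fun m hm => by
    ext i; simp [Fin.ext_iff]; omega
  have hall : ∀ {n : ℕ}, (Finset.univ.filter fun i : Fin n => (i : ℕ) < n) = Finset.univ := by
    intro n; ext i; simp
  have main : ∀ m ≤ K, ∫⁻ ω, ∏ i ∈ Finset.univ.filter (fun i : Fin K => (i : ℕ) < m),
      ∏ j, Z i j ω ∂μ ≤ 1 := by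
    intro m
    induction m with
    | zero => intro _; simp
    | succ m ih =>
      intro hm
      refine le_trans ?_ (ih (by omega))
      have inner : ∀ l ≤ H, ∫⁻ ω, (∏ i ∈ Finset.univ.filter (fun i : Fin K => (i : ℕ) < m),
          ∏ j, Z i j ω) * ∏ j ∈ Finset.univ.filter (fun j : Fin H => (j : ℕ) < l),
            Z ⟨m, hm⟩ j ω ∂μ ≤
          ∫⁻ ω, ∏ i ∈ Finset.univ.filter (fun i : Fin K => (i : ℕ) < m), ∏ j, Z i j ω ∂μ := by
        intro l
        induction l with
        | zero => intro _; simp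
        | succ l ihl =>
          intro hl
          refine le_trans ?_ (ihl (by omega))
          have hφ : Measurable[history D ⟨m, hm⟩ ⟨l, hl⟩] fun ω =>
              (∏ i ∈ Finset.univ.filter (fun i : Fin K => (i : ℕ) < m), ∏ j, Z i j ω) *
                ∏ j ∈ Finset.univ.filter (fun j : Fin H => (j : ℕ) < l), Z ⟨m, hm⟩ j ω := by
            refine Measurable.mul ?_ ?_
            · refine Finset.measurable_fun_prod _ fun i hi =>
                Finset.measurable_fun_prod _ fun j _ => hZlt _ _ i ?_ j
              simpa [Fin.lt_def] using hi
            · refine Finset.measurable_fun_prod _ fun j hj => hZle _ _ j ?_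
              simpa [Fin.lt_def] using hj
          refine le_trans (le_of_eq ?_) (hD.lintegral_mul_le ⟨m, hm⟩ ⟨l, hl⟩ hφ hg hg1)
          refine lintegral_congr fun ω => ?_
          rw [hins l hl, Finset.prod_insert (by simp), mul_assoc]
          congr 1
          exact mul_comm _ _
      refine le_trans (le_of_eq ?_) (inner H le_rfl)
      refine lintegral_congr fun ω => ?_
      rw [hins m hm, Finset.prod_insert (by simp), hall, mul_comm]
  have := main K le_rfl
  rwa [hall] at this

theorem IsOfflineDataset.measurable_transition (hD : IsOfflineDataset μ Pstar s₀ D) (k : Fin K)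
    (h : Fin H) : Measurable fun ω => (((D ω).state k h.castSucc, (D ω).action k h),
      (D ω).state k h.succ) :=
  ((hD.measurable_state k _).prodMk (hD.measurable_action k h)).prodMk (hD.measurable_state k _)

theorem IsOfflineDataset.measurable_likelihoodRatio (hD : IsOfflineDataset μ Pstar s₀ D)
    (P : Model S A ν) : Measurable fun ω => likelihoodRatio P Pstar (D ω) := by
  have hm : ∀ k h, Measurable fun ω => hellingerRatio P Pstar
      ((D ω).state k h.castSucc, (D ω).action k h) ((D ω).state k h.succ) := fun k h => by
    have hc := (measurable_hellingerRatio P Pstar).comp (hD.measurable_transition k h)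
    simp only [Function.comp_def] at hc
    exact hc
  unfold likelihoodRatio
  exact Finset.measurable_fun_prod _ fun k _ => Finset.measurable_fun_prod _ fun h _ => hm k h

theorem IsOfflineDataset.lintegral_likelihoodRatio_le_one (hD : IsOfflineDataset μ Pstar s₀ D)
    (P : Model S A ν) : ∫⁻ ω, ENNReal.ofReal (likelihoodRatio P Pstar (D ω)) ∂μ ≤ 1 := by
  refine le_trans (le_of_eq (lintegral_congr fun ω => ?_))
    (hD.lintegral_prod_le_one (measurable_hellingerRatio P Pstar).ennreal_ofReal
      (lintegral_hellingerRatio_le_one P Pstar))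
  rw [likelihoodRatio, ENNReal.ofReal_prod_of_nonneg fun k _ =>
    Finset.prod_nonneg fun h _ => hellingerRatio_nonneg _ _ _ _]
  refine Finset.prod_congr rfl fun k _ => ?_
  rw [ENNReal.ofReal_prod_of_nonneg fun h _ => hellingerRatio_nonneg _ _ _ _]

theorem IsOfflineDataset.measure_likelihoodRatio_ge_le (hD : IsOfflineDataset μ Pstar s₀ D)
    (P : Model S A ν) {a : ℝ} (ha : 0 < a) :
    μ {ω | a ≤ likelihoodRatio P Pstar (D ω)} ≤ ENNReal.ofReal a⁻¹ := by
  have h1 : μ {ω | ENNReal.ofReal a ≤ ENNReal.ofReal (likelihoodRatio P Pstar (D ω))} ≤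
      ENNReal.ofReal a⁻¹ := by
    refine (meas_ge_le_lintegral_div
      (hD.measurable_likelihoodRatio P).ennreal_ofReal.aemeasurable
      (ENNReal.ofReal_pos.2 ha).ne' ENNReal.ofReal_ne_top).trans ?_
    rw [ENNReal.ofReal_inv_of_pos ha, ← one_div]
    exact ENNReal.div_le_div_right (hD.lintegral_likelihoodRatio_le_one P) _
  exact (measure_mono fun ω hω => ENNReal.ofReal_le_ofReal hω).trans h1

theorem IsOfflineDataset.ae_likelihood_pos (hD : IsOfflineDataset μ Pstar s₀ D) :
    ∀ᵐ ω ∂μ, 0 < likelihood Pstar (D ω) := by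
  filter_upwards [ae_all_iff.2 fun k => ae_all_iff.2 fun h => hD.ae_dens_pos k h] with ω hω
  exact Finset.prod_pos fun k _ => Finset.prod_pos fun h _ => hω k h

theorem IsOfflineDataset.measurable_likelihood (hD : IsOfflineDataset μ Pstar s₀ D) :
    Measurable fun ω => likelihood Pstar (D ω) :=
  Finset.measurable_fun_prod _ fun k _ => Finset.measurable_fun_prod _ fun h _ =>
    Pstar.measurable_dens.comp (hD.measurable_transition k h)

/-- The guarantees of the version space around the maximum likelihood estimator hold with
probability at least `1 - δ`. -/
theorem IsOfflineDataset.exists_event (hD : IsOfflineDataset μ Pstar s₀ D)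
    {ℳ : Finset (Model S A ν)} (hℳ : Pstar ∈ ℳ) {δ : ℝ} (hδ : 0 < δ) (hδ1 : δ < 1) :
    ∃ E : Set Ω, MeasurableSet E ∧ ENNReal.ofReal (1 - δ) ≤ μ E ∧ ∀ ω ∈ E,
      Pstar ∈ versionSpace ℳ (4 * Real.log (ℳ.card / δ)) (D ω) ∧
      ∀ P ∈ versionSpace ℳ (4 * Real.log (ℳ.card / δ)) (D ω),
        ∑ k : Fin K, ∑ h : Fin H,
          (hellingerSq P Pstar ((D ω).state k h.castSucc, (D ω).action k h)).toReal ≤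
            3 * Real.log (ℳ.card / δ) := by
  have hN : (1 : ℝ) ≤ ℳ.card := by exact_mod_cast Finset.card_pos.2 ⟨_, hℳ⟩
  have hq : 1 ≤ (ℳ.card : ℝ) / δ := by rw [le_div_iff₀ hδ]; linarith
  have hpos : 0 < (ℳ.card : ℝ) / δ := by linarith
  have hBm : MeasurableSet (⋃ P ∈ ℳ, {ω | ℳ.card / δ ≤ likelihoodRatio P Pstar (D ω)}) :=
    Finset.measurableSet_biUnion _ fun P _ =>
      measurableSet_le measurable_const (hD.measurable_likelihoodRatio P)
  have hBμ : μ (⋃ P ∈ ℳ, {ω | ℳ.card / δ ≤ likelihoodRatio P Pstar (D ω)}) ≤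
      ENNReal.ofReal δ := by
    refine (measure_biUnion_finset_le _ _).trans ((Finset.sum_le_sum fun P _ =>
      hD.measure_likelihoodRatio_ge_le P hpos).trans (le_of_eq ?_))
    rw [Finset.sum_const, nsmul_eq_mul, ← ENNReal.ofReal_natCast, ← ENNReal.ofReal_mul (by simp)]
    congr 1
    field_simp
  refine ⟨{ω | 0 < likelihood Pstar (D ω)} ∩
    (⋃ P ∈ ℳ, {ω | ℳ.card / δ ≤ likelihoodRatio P Pstar (D ω)})ᶜ,
    (measurableSet_lt measurable_const hD.measurable_likelihood).inter hBm.compl, ?_,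
    fun ω hω => ?_⟩
  · have h1 : μ ({ω | 0 < likelihood Pstar (D ω)} ∩
        (⋃ P ∈ ℳ, {ω | ℳ.card / δ ≤ likelihoodRatio P Pstar (D ω)})ᶜ) =
        μ (⋃ P ∈ ℳ, {ω | ℳ.card / δ ≤ likelihoodRatio P Pstar (D ω)})ᶜ := by
      refine measure_congr ?_
      filter_upwards [hD.ae_likelihood_pos] with ω hω
      exact propext ⟨fun h => h.2, fun h => ⟨hω, h⟩⟩
    rw [h1, prob_compl_eq_one_sub hBm, ENNReal.ofReal_sub _ hδ.le, ENNReal.ofReal_one]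
    exact tsub_le_tsub_left hBμ 1
  · refine mem_versionSpace_and_sum_hellingerSq_le hℳ (D ω) (Real.log_nonneg hq) hω.1
      fun P hP => ?_
    rw [Real.exp_log hpos]
    by_contra! hc
    exact hω.2 (Set.mem_biUnion hP hc)

end Data
end OfflineRL

namespace OfflineRL

/-! ### Transfer by concentrability, and pessimism -/

section Pessimism

variable {S A : Type*} [MeasurableSpace S] [MeasurableSpace A] {ν : Measure S} [SigmaFinite ν]

/-- The bounds at each time step add up to the Hellinger error of the whole data set, which the
likelihood argument controls at once; hence no factor H. -/
theorem sum_lintegral_occupancy_le {H K : ℕ} (hK : 0 < K) {ℳ : Finset (Model S A ν)}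
    {P Q : Model S A ν} (hP : P ∈ ℳ) (s₀ : S) (π : Policy S A) (D : Dataset S A H K) {C : ℝ≥0}
    (hC : concentrability ℳ Q s₀ π D ≤ C) :
    ∑ h : Fin H, ∫⁻ x, hellingerSq P Q x ∂(occupancy H Q π s₀ h) ≤
      ENNReal.ofReal (C * (∑ k : Fin K, ∑ h : Fin H,
        (hellingerSq P Q (D.state k h.castSucc, D.action k h)).toReal) / K) := by
  have hK' : (K : ℝ≥0∞) ≠ 0 := by exact_mod_cast hK.ne'
  have h1 : ∀ h : Fin H, ∫⁻ x, hellingerSq P Q x ∂(occupancy H Q π s₀ h) ≤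
      C * ((K : ℝ≥0∞)⁻¹ * ∑ k : Fin K, hellingerSq P Q (D.state k h.castSucc, D.action k h)) :=
    fun h => by
      -- A zero data average is harmless: since C is finite, x/0 = ∞ forces x = 0.
      rw [← ENNReal.div_le_iff_le_mul (Or.inr ENNReal.coe_ne_top) (Or.inl (ENNReal.mul_ne_top
        (ENNReal.inv_ne_top.2 hK') (ENNReal.sum_ne_top.2 fun k _ => hellingerSq_ne_top _ _ _)))]
      exact le_trans (le_iSup_of_le h (le_iSup₂ (f := fun (P : Model S A ν) (_ : P ∈ ℳ) =>
        (∫⁻ x, hellingerSq P Q x ∂(occupancy H Q π s₀ h)) / ((K : ℝ≥0∞)⁻¹ *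
          ∑ k : Fin K, hellingerSq P Q (D.state k h.castSucc, D.action k h))) P hP)) hC
  refine (Finset.sum_le_sum fun h _ => h1 h).trans (le_of_eq ?_)
  have hK0 : (0 : ℝ) < K := by exact_mod_cast hK
  rw [← Finset.mul_sum, ← Finset.mul_sum, Finset.sum_comm, mul_div_assoc, div_eq_inv_mul,
    ENNReal.ofReal_mul NNReal.zero_le_coe, ENNReal.ofReal_mul (by positivity),
    ENNReal.ofReal_inv_of_pos hK0, ENNReal.ofReal_natCast, ENNReal.ofReal_coe_nnreal,
    ENNReal.ofReal_sum_of_nonneg fun k _ => Finset.sum_nonneg fun h _ => ENNReal.toReal_nonneg]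
  congr 2
  refine Finset.sum_congr rfl fun k _ => ?_
  rw [ENNReal.ofReal_sum_of_nonneg fun h _ => ENNReal.toReal_nonneg]
  refine Finset.sum_congr rfl fun h _ => ?_
  rw [ENNReal.ofReal_toReal (hellingerSq_ne_top _ _ _)]

/-- Pessimism: the suboptimality of the output is at most the worst simulation error of the
comparator over the version space. -/
theorem IsPessimisticPolicy.exists_value_sub_le {H K : ℕ} {r : S × A → ℝ} {s₀ : S}
    {ℳ : Finset (Model S A ν)} {β : ℝ} {D : Dataset S A H K} {πhat : Policy S A}
    (hhat : IsPessimisticPolicy r s₀ ℳ β D πhat) {Q : Model S A ν}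
    (hQ : Q ∈ versionSpace ℳ β D) (π : Policy S A) :
    ∃ P ∈ versionSpace ℳ β D, value r H Q π 0 s₀ - value r H Q πhat 0 s₀ ≤
      value r H Q π 0 s₀ - value r H P π 0 s₀ := by
  have hfin : Finite (versionSpace ℳ β D) :=
    (ℳ.finite_toSet.subset fun P hP => hP.1).to_subtype
  have hne : Nonempty (versionSpace ℳ β D) := ⟨⟨Q, hQ⟩⟩
  obtain ⟨P, hP⟩ := exists_eq_ciInf_of_finite (f := fun P : versionSpace ℳ β D =>
    value r H P.1 π 0 s₀)
  have h1 : ⨅ P : versionSpace ℳ β D, value r H P.1 πhat 0 s₀ ≤ value r H Q πhat 0 s₀ :=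
    ciInf_le (f := fun P : versionSpace ℳ β D => value r H P.1 πhat 0 s₀)
      (Set.finite_range _).bddBelow ⟨Q, hQ⟩
  have h2 := hhat π
  rw [← hP] at h2
  exact ⟨P.1, P.2, by linarith⟩

end Pessimism

end OfflineRL

/-! ### Assembly of the regret bound -/

theorem mainTheorem2 :
    ∃ c : ℝ, 0 < c ∧
      ∀ (S : Type u) [MeasurableSpace S] (A : Type v) [MeasurableSpace A]
        (ν : Measure S) [SigmaFinite ν]
        (Ω : Type w) [MeasurableSpace Ω] (μ : Measure Ω) [IsProbabilityMeasure μ]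
        (H K : ℕ) (_ : 0 < H) (_ : 0 < K)
        (r : S × A → ℝ) (_ : Measurable r) (s₀ : S)
        (ℳ : Finset (Model S A ν)) (Pstar : Model S A ν) (_ : Pstar ∈ ℳ)
        (_ : ∀ (π : Policy S A) (h : ℕ), h ≤ H → ∀ P ∈ ℳ, ∀ s : S,
          value r H P π h s ∈ Set.Icc (0 : ℝ) 1)
        (D : Ω → Dataset S A H K) (_ : IsOfflineDataset μ Pstar s₀ D)
        (δ : ℝ) (_ : 0 < δ) (_ : δ < 1),
        ∃ E : Set Ω, MeasurableSet E ∧ ENNReal.ofReal (1 - δ) ≤ μ E ∧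
          ∀ ω ∈ E, ∀ πhat : Policy S A,
            IsPessimisticPolicy r s₀ ℳ (4 * Real.log (ℳ.card / δ)) (D ω) πhat →
            ∀ (πstar : Policy S A) (C : ℝ≥0),
              concentrability ℳ Pstar s₀ πstar (D ω) ≤ (C : ℝ≥0∞) →
              value r H Pstar πstar 0 s₀ - value r H Pstar πhat 0 s₀ ≤
                c * (√(C * returnVar r H Pstar πstar s₀ * Real.log (ℳ.card / δ) / K)
                  + C * Real.log (ℳ.card / δ) / K) := by
  -- 456 = 3 · 152: the simulation constant times the 3 of the bound 3L.
  refine ⟨456, by norm_num, ?_⟩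
  intro S _ A _ ν _ Ω _ μ _ H K hH hK r hrm s₀ ℳ Pstar hstar hval D hD δ hδ hδ1
  obtain ⟨E, hEm, hEμ, hE⟩ := hD.exists_event hstar hδ hδ1
  refine ⟨E, hEm, hEμ, fun ω hω πhat hhat πstar C hC => ?_⟩
  obtain ⟨hmem, hsum⟩ := hE ω hω
  obtain ⟨P, hP, hle⟩ := hhat.exists_value_sub_le hmem πstar
  have hr := reward_mem_Icc hH Pstar (fun π h hh s => hval π h hh Pstar hstar s) hrm
  -- Beyond the horizon the truncated subtraction makes the value 0, so the bound holds at all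
  -- times.
  have hV : ∀ P ∈ ℳ, ∀ h s, value r H P πstar h s ∈ Set.Icc (0 : ℝ) 1 := fun P hP h s => by
    rcases le_total h H with hh | hh
    · exact hval πstar h hh P hP s
    · rw [value_of_le hh]; simp
  have hsim := abs_value_sub_le hrm hr (hV P hP.1) (hV Pstar hstar) s₀
  have herr := sum_lintegral_occupancy_le hK hP.1 s₀ πstar (D ω) hC
  have hK0 : (0 : ℝ) < K := by exact_mod_cast hK
  have hnn : 0 ≤ ∑ k : Fin K, ∑ h : Fin H,
      (hellingerSq P Pstar ((D ω).state k h.castSucc, (D ω).action k h)).toReal :=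
    Finset.sum_nonneg fun k _ => Finset.sum_nonneg fun h _ => ENNReal.toReal_nonneg
  rw [sum_lintegral_occupancy, ENNReal.ofReal_le_ofReal_iff (by positivity)] at herr
  have hsumP := hsum P hP
  set e := expSum Pstar πstar
    (fun h s => (hellingerSq P Pstar (s, πstar.act h s)).toReal) H 0 s₀
  set L := Real.log (ℳ.card / δ)
  set Y := returnVar r H Pstar πstar s₀
  have hY : 0 ≤ Y := variance_nonneg _ _
  have hL : 0 ≤ L := by linarith
  have he : e ≤ 3 * (C * L / K) := by
    refine herr.trans ?_
    rw [← mul_div_assoc, ← mul_left_comm]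
    gcongr
  have hsqrt : √(e * Y) ≤ 3 * √(C * Y * L / K) := by
    have h3 : e * Y ≤ 3 ^ 2 * (C * Y * L / K) := by
      have h4 : e * Y ≤ 3 * (C * L / K) * Y := by gcongr
      have h5 : 3 * (C * L / K) * Y = 3 * (C * Y * L / K) := by ring
      have h6 : 0 ≤ C * Y * L / K := by positivity
      linarith
    refine (Real.sqrt_le_sqrt h3).trans (le_of_eq ?_)
    rw [Real.sqrt_mul (by norm_num), Real.sqrt_sq (by norm_num)]
  have habs := neg_abs_le (value r H P πstar 0 s₀ - value r H Pstar πstar 0 s₀)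
  linarith
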